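/- Let $|\psi\rangle\in\mathbb{C}^{d_A}\otimes\mathbb{C}^{d_B}$ be a unit vector, $\psi=|\psi\rangle\langle\psi|$, $d=\min\{d_A,d_B\}$, and let $\varepsilon\in[0,1)$. Let $\xi_\psi=(\alpha_1,\dots,\alpha_d)\in\mathbb{R}^d_+$ be the vector of Schmidt coefficients of $|\psi\rangle$, i.e. $|\psi\rangle=\sum_{i=1}^d\alpha_i\,|e_i\rangle\otimes|f_i\rangle$ with $\alpha_i\ge 0$ and orthonormal families $(e_i)$, $(f_i)$ (such a decomposition exists). For bipartite systems write $T_B$ for the partial transpose on the second party, $\mathsf{SEP}$ for the convex hull of the pure product states, $\mathsf{PPT}_+$ for the set of density matrices $X$ with $X^{T_B}\succeq0$, and $\mathsf{R}=\{X\succeq 0: \|X^{T_B}\|_1\le 1\}$ for the Rains set. Let $\mathcal{O}$ be any one of the following classes of completely positive trace-preserving (CPTP) maps $\Lambda:AB\to A'B'$: * 1-LOCC: $\Lambda=\sum_j E_j\otimes D_j$ (a finite sum), where $\{E_j\}$ is an instrument of Alice (completely positive maps whose sum is trace preserving) and every $D_j$ is a CPTP map of Bob; * LOCC: maps implemented by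 local operations and classical communication with finitely many rounds, where in every round one party applies an instrument (with finitely many outcomes, chosen depending on the earlier outcomes) to its own system and announces the outcome; * PPT: CPTP maps such that $T_{B'}\circ\Lambda\circ T_B$ is completely positive; * Rains-preserving maps: CPTP maps with $\Lambda(\mathsf{R})\subseteq\mathsf{R}$; * $\mathsf{PPT}_+$-preserving maps: CPTP maps with $\Lambda(\mathsf{PPT}_+)\subseteq\mathsf{PPT}_+$; * SEPP (separability-preserving maps): CPTP maps with $\Lambda(\mathsf{SEP})\subseteq\mathsf{SEP}$. Let $|\Psi_m\rangle=\frac1{\sqrt m}\sum_{i=1}^m|ii\rangle$ and $\Psi_m=|\Psi_m\rangle\langle\Psi_m|$. Define the fidelity of distillation $F_{\mathcal O}(\rho,m)=\sup_{\Lambda\in\mathcal O}\operatorname{Tr}(\Lambda(\rho)\Psi_m)$, the supremum being over the maps in $\mathcal O$ with output space $\mathbb{C}^m\otimes\mathbb{C}^m$, and the one-shot $\varepsilon$-error distillable entanglement $$E^{(1),\varepsilon}_{d,\mathcal O}(\rho)=\log_2\max\{m\in\mathbb{N},\ m\ge1: F_{\mathcal O}(\rho,m)\ge 1-\varepsilon\}.$$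 Write $\lfloor x\rfloor_{\log}=\log_2\lfloor 2^x\rfloor$. Then, for each of these six classes $\mathcal O$, the maximum defining $E^{(1),\varepsilon}_{d,\mathcal O}(\psi)$ exists and $$E^{(1),\varepsilon}_{d,\mathcal O}(\psi)=\Big\lfloor-\log_2\min\big\{\|\omega\|_{\infty}^2:\ \omega\in\mathbb{R}^d_+,\ \langle\xi_\psi,\omega\rangle\ge\sqrt{1-\varepsilon},\ \|\omega\|_{2}\le1\big\}\Big\rfloor_{\log},$$ where the minimum is attained and positive. Moreover this minimum is the optimal value of a convex quadratically constrained linear program, namely: minimise $s$ over $(\omega,s)\in\mathbb{R}^d\times\mathbb{R}$ subject to $\omega_i^2\le s$ and $\omega_i\ge0$ for all $i$, $\sum_i\omega_i^2\le1$ and $\langle\xi_\psi,\omega\rangle\ge\sqrt{1-\varepsilon}$; a pair $(\omega,s)$ is feasible for it if and only if $\omega$ is feasible for the minimisation above and $\|\omega\|_\infty^2\le s$. -/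

import Mathlib

open scoped Matrix ComplexOrder

noncomputable section

/-- A linear map between matrix algebras (a candidate quantum operation). -/
abbrev SuperOp (n k : Type) : Type := Matrix n n ℂ →ₗ[ℂ] Matrix k k ℂ

/-- `E ⊗ id` on the operators of a bipartite system. -/
def SuperOp.onLeft {a a' : Type} (E : SuperOp a a') (b : Type) : SuperOp (a × b) (a' × b) where
  toFun X := Matrix.of fun p q => E (Matrix.of fun i j => X (i, p.2) (j, q.2)) p.1 q.1
  map_add' X Y := by
    ext p q
    exact congrFun (congrFun (E.map_add (Matrix.of fun i j => X (i, p.2) (j, q.2))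
      (Matrix.of fun i j => Y (i, p.2) (j, q.2))) p.1) q.1
  map_smul' z X := by
    ext p q
    exact congrFun (congrFun (E.map_smul z
      (Matrix.of fun i j => X (i, p.2) (j, q.2))) p.1) q.1

/-- `id ⊗ D` on the operators of a bipartite system. -/
def SuperOp.onRight {b b' : Type} (D : SuperOp b b') (a : Type) : SuperOp (a × b) (a × b') where
  toFun X := Matrix.of fun p q => D (Matrix.of fun i j => X (p.1, i) (q.1, j)) p.2 q.2
  map_add' X Y := by
    ext p q
    exact congrFun (congrFun (D.map_add (Matrix.of fun i j => X (p.1, i) (q.1, j))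
      (Matrix.of fun i j => Y (p.1, i) (q.1, j))) p.2) q.2
  map_smul' z X := by
    ext p q
    exact congrFun (congrFun (D.map_smul z
      (Matrix.of fun i j => X (p.1, i) (q.1, j))) p.2) q.2

/-- The tensor product `E ⊗ D` of two maps. -/
def SuperOp.tensor {a a' b b' : Type} (E : SuperOp a a') (D : SuperOp b b') :
    SuperOp (a × b) (a' × b') :=
  (E.onLeft b').comp (D.onRight a)

/-- Complete positivity: `id_r ⊗ Λ` preserves positive semidefiniteness for every `r`. -/
def SuperOp.IsCP {n k : Type} (Λ : SuperOp n k) : Prop :=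
  ∀ (r : ℕ) (X : Matrix (Fin r × n) (Fin r × n) ℂ),
    X.PosSemidef → (Λ.onRight (Fin r) X).PosSemidef

/-- Completely positive and trace preserving. -/
def SuperOp.IsCPTP {n k : Type} [Fintype n] [Fintype k] (Λ : SuperOp n k) : Prop :=
  Λ.IsCP ∧ ∀ X, (Λ X).trace = X.trace

/-- A quantum instrument: finitely many completely positive maps, possibly with different output
systems, whose sum of traces is preserved. -/
def IsInstrument {n N : ℕ} {k : Fin N → ℕ} (E : ∀ j, SuperOp (Fin n) (Fin (k j))) : Prop :=
  (∀ j, (E j).IsCP) ∧ ∀ X, ∑ j, (E j X).trace = X.trace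

/-- Partial transpose on the second party. -/
def partialTranspose (a b : Type) : SuperOp (a × b) (a × b) where
  toFun X := Matrix.of fun p q => X (p.1, q.2) (q.1, p.2)
  map_add' _ _ := rfl
  map_smul' _ _ := rfl

/-- The trace norm `Tr √(Xᴴ X)`, as the sum of the singular values. -/
def traceNorm {n : Type} [Fintype n] [DecidableEq n] (X : Matrix n n ℂ) : ℝ :=
  ∑ i, Real.sqrt ((Matrix.isHermitian_conjTranspose_mul_self X).eigenvalues i)

/-- The rank-one operator `|x⟩⟨x|`. -/
def rankOne {n : Type} (x : n → ℂ) : Matrix n n ℂ := Matrix.vecMulVec x (star x)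

/-- The set of separable states: the convex hull of the pure product states. -/
def separableStates (a b : ℕ) : Set (Matrix (Fin a × Fin b) (Fin a × Fin b) ℂ) :=
  convexHull ℝ {X | ∃ (φ : EuclideanSpace ℂ (Fin a)) (η : EuclideanSpace ℂ (Fin b)),
    ‖φ‖ = 1 ∧ ‖η‖ = 1 ∧ X = rankOne fun p => φ p.1 * η p.2}

/-- The set of states with positive partial transpose. -/
def pptStates (a b : ℕ) : Set (Matrix (Fin a × Fin b) (Fin a × Fin b) ℂ) :=
  {X | X.trace = 1 ∧ X.PosSemidef ∧ (partialTranspose (Fin a) (Fin b) X).PosSemidef}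

/-- The Rains set. -/
def rainsSet (a b : ℕ) : Set (Matrix (Fin a × Fin b) (Fin a × Fin b) ℂ) :=
  {X | X.PosSemidef ∧ traceNorm (partialTranspose (Fin a) (Fin b) X) ≤ 1}

/-- One-way LOCC: Alice applies an instrument and sends the outcome `j` to Bob, who applies a
channel depending on `j`. -/
def IsOneWayLOCC {a b a' b' : ℕ} (Λ : SuperOp (Fin a × Fin b) (Fin a' × Fin b')) : Prop :=
  ∃ (N : ℕ) (E : Fin N → SuperOp (Fin a) (Fin a')) (D : Fin N → SuperOp (Fin b) (Fin b')),
    IsInstrument E ∧ (∀ j, (D j).IsCPTP) ∧ Λ = ∑ j, (E j).tensor (D j)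

/-- LOCC: protocols with finitely many rounds. In each round one party applies an instrument to
its own system and broadcasts the outcome; the rest of the protocol may depend on this outcome.
At the end both parties apply local channels. -/
inductive IsLOCC {a' b' : ℕ} :
    ∀ {a b : ℕ}, SuperOp (Fin a × Fin b) (Fin a' × Fin b') → Prop
  | localOps {a b : ℕ} (E : SuperOp (Fin a) (Fin a')) (D : SuperOp (Fin b) (Fin b'))
      (hE : E.IsCPTP) (hD : D.IsCPTP) : IsLOCC (E.tensor D)
  | alice {a b N : ℕ} (c : Fin N → ℕ) (E : ∀ j, SuperOp (Fin a) (Fin (c j)))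
      (Λ : ∀ j, SuperOp (Fin (c j) × Fin b) (Fin a' × Fin b'))
      (hE : IsInstrument E) (hΛ : ∀ j, IsLOCC (Λ j)) :
      IsLOCC (∑ j, (Λ j).comp ((E j).onLeft (Fin b)))
  | bob {a b N : ℕ} (c : Fin N → ℕ) (D : ∀ j, SuperOp (Fin b) (Fin (c j)))
      (Λ : ∀ j, SuperOp (Fin a × Fin (c j)) (Fin a' × Fin b'))
      (hD : IsInstrument D) (hΛ : ∀ j, IsLOCC (Λ j)) :
      IsLOCC (∑ j, (Λ j).comp ((D j).onRight (Fin a)))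

/-- The six classes of operations under consideration. -/
inductive OpClass : Type
  | oneWayLOCC
  | LOCC
  | PPT
  | rainsPreserving
  | pptPreserving
  | separabilityPreserving

/-- The operations `AB → A'B'` in a given class, where `a, b, a', b'` are the local dimensions. -/
def OpClass.ops (a b a' b' : ℕ) : OpClass → Set (SuperOp (Fin a × Fin b) (Fin a' × Fin b'))
  | .oneWayLOCC => {Λ | IsOneWayLOCC Λ}
  | .LOCC => {Λ | IsLOCC Λ}
  | .PPT => {Λ | Λ.IsCPTP ∧
      SuperOp.IsCP ((partialTranspose (Fin a') (Fin b')).comp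
        (Λ.comp (partialTranspose (Fin a) (Fin b))))}
  | .rainsPreserving => {Λ | Λ.IsCPTP ∧ ∀ X ∈ rainsSet a b, Λ X ∈ rainsSet a' b'}
  | .pptPreserving => {Λ | Λ.IsCPTP ∧ ∀ X ∈ pptStates a b, Λ X ∈ pptStates a' b'}
  | .separabilityPreserving =>
      {Λ | Λ.IsCPTP ∧ ∀ X ∈ separableStates a b, Λ X ∈ separableStates a' b'}

/-- The maximally entangled state `Ψ_m` on `ℂ^m ⊗ ℂ^m`. -/
def maxEntangled (m : ℕ) : Matrix (Fin m × Fin m) (Fin m × Fin m) ℂ :=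
  rankOne fun p => if p.1 = p.2 then ((1 / Real.sqrt m : ℝ) : ℂ) else 0

/-- The fidelity of distillation `sup ⟨Λ(ρ), Ψ_m⟩` over the operations `Λ` of the class. -/
def distillationFidelity (O : OpClass) {a b : ℕ}
    (ρ : Matrix (Fin a × Fin b) (Fin a × Fin b) ℂ) (m : ℕ) : ℝ :=
  sSup {x | ∃ Λ ∈ O.ops a b m m, x = (((Λ ρ)ᴴ * maxEntangled m).trace).re}

/-- The sizes `m ≥ 1` of maximally entangled states distillable within error `ε`. -/
def distillableSizes (O : OpClass) {a b : ℕ}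
    (ρ : Matrix (Fin a × Fin b) (Fin a × Fin b) ℂ) (ε : ℝ) : Set ℕ :=
  {m | 1 ≤ m ∧ 1 - ε ≤ distillationFidelity O ρ m}

/-- The one-shot `ε`-error distillable entanglement. -/
def distillableEntanglement (O : OpClass) {a b : ℕ}
    (ρ : Matrix (Fin a × Fin b) (Fin a × Fin b) ℂ) (ε : ℝ) : ℝ :=
  Real.logb 2 (sSup (distillableSizes O ρ ε) : ℕ)

/-- `ξ` is a vector of Schmidt coefficients of `ψ`. -/
def IsSchmidtVector {a b : ℕ} (ψ : EuclideanSpace ℂ (Fin a × Fin b))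
    (ξ : Fin (min a b) → ℝ) : Prop :=
  (∀ i, 0 ≤ ξ i) ∧
  ∃ (e : Fin (min a b) → EuclideanSpace ℂ (Fin a)) (f : Fin (min a b) → EuclideanSpace ℂ (Fin b)),
    Orthonormal ℂ e ∧ Orthonormal ℂ f ∧ ∀ p, ψ p = ∑ i, (ξ i : ℂ) * (e i p.1 * f i p.2)

/-- `log₂ ⌊2^x⌋`. -/
def logFloor (x : ℝ) : ℝ := Real.logb 2 (⌊(2 : ℝ) ^ x⌋ : ℤ)

/-- The feasible vectors `ω ∈ ℝ^d_+` with `⟨ξ, ω⟩ ≥ √(1 - ε)` and `‖ω‖₂ ≤ 1`. -/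
def feasibleVectors {d : ℕ} (ξ : Fin d → ℝ) (ε : ℝ) : Set (Fin d → ℝ) :=
  {ω | Real.sqrt (1 - ε) ≤ ξ ⬝ᵥ ω ∧ ‖WithLp.toLp 2 ω‖ ≤ 1 ∧ ∀ i, 0 ≤ ω i}

/-- A quadratically constrained linear program: minimise `c ⬝ x` over the real vectors `x` with
`x ⬝ P_k x + q_k ⬝ x + r_k ≤ 0` for all `k`. -/
structure QCLP (ι κ : Type) [Fintype ι] [Fintype κ] where
  c : ι → ℝ
  P : κ → Matrix ι ι ℝ
  q : κ → ι → ℝ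
  r : κ → ℝ

/-- The program is convex: all its quadratic forms are positive semidefinite. -/
def QCLP.IsConvex {ι κ : Type} [Fintype ι] [Fintype κ] (Q : QCLP ι κ) : Prop :=
  ∀ k, (Q.P k).PosSemidef

/-- The feasible set of the program. -/
def QCLP.feasible {ι κ : Type} [Fintype ι] [Fintype κ] (Q : QCLP ι κ) : Set (ι → ℝ) :=
  {x | ∀ k, x ⬝ᵥ (Q.P k *ᵥ x) + Q.q k ⬝ᵥ x + Q.r k ≤ 0}

/-- The program in the variables `(ω, s)`: minimise `s` subject to `ω i ^ 2 ≤ s` and `0 ≤ ω i` for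
all `i`, `∑ i, ω i ^ 2 ≤ 1` (the index `true`) and `√(1 - ε) ≤ ⟨ξ, ω⟩` (the index `false`). -/
def pureStateQCLP {d : ℕ} (ξ : Fin d → ℝ) (ε : ℝ) :
    QCLP (Fin d ⊕ Unit) (Fin d ⊕ Fin d ⊕ Bool) where
  c := Pi.single (Sum.inr ()) 1
  P
    | .inl i => Matrix.diagonal (Pi.single (Sum.inl i) 1)
    | .inr (.inl _) => 0
    | .inr (.inr true) => Matrix.diagonal (Sum.elim 1 0)
    | .inr (.inr false) => 0
  q
    | .inl _ => Pi.single (Sum.inr ()) (-1)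
    | .inr (.inl i) => Pi.single (Sum.inl i) (-1)
    | .inr (.inr true) => 0
    | .inr (.inr false) => Sum.elim (-ξ) 0
  r
    | .inl _ => 0
    | .inr (.inl _) => 0
    | .inr (.inr true) => -1
    | .inr (.inr false) => Real.sqrt (1 - ε)

end

noncomputable section

/-! ### Positive semidefinite matrices -/

section Matrices

variable {n : Type} [Fintype n]

/-! For every class the fidelity `F(m)` is governed by the maximum of `⟨ξ, ω⟩ ^ 2` over `ω ≥ 0` with
`‖ω‖₂ ≤ 1` and `ω i ^ 2 ≤ 1 / m`. Hence `F(m) ≥ 1 - ε` exactly when some feasible `ω` has `‖ω‖∞ ^ 2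
≤ 1 / m`, i.e. when `μ ≤ 1 / m`, and the largest such `m` is `⌊1 / μ⌋`.

Upper bound (`exists_vector_of_mem_ops`). All six classes send separable states into the Rains set,
whose elements overlap `Ψ_m` by at most `1 / m`, because the partial transpose of `Ψ_m` is the swap
operator divided by `m`. The pulled-back effect `W = Λ†(Ψ_m)` is positive; writing `W = B† B` gives
a contraction `T = B` such that `‖T x‖ ^ 2` is the fidelity reached from `x`, and `‖T u_i‖ ^ 2 ≤ 1 /
m` on the Schmidt vectors `u_i = e_i ⊗ f_i`. The numbers `ω i = |⟨T u_i, T ψ⟩| / ‖T ψ‖` then meet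
all constraints (`exists_vector_of_contraction`).

Lower bound (`exists_oneWayLOCC`). One-way LOCC lies in all the other classes, so a single protocol
suffices. The vector `m * ω i ^ 2` has entries in `[0, 1]` and sum at most `m`, so by Birkhoff's
theorem it is a mean of indicators of subsets of size at most `m` (`exists_weights_perm`). Alice
filters onto a random such subset with amplitudes proportional to `1 / ω i`; both parties relabel
the subset inside `Fin m`. Cauchy–Schwarz over the outcomes gives fidelity at least `⟨ξ, ω⟩ ^ 2`. -/

theorem Matrix.IsHermitian.eq_mul_diagonal_mul [DecidableEq n] {A : Matrix n n ℂ}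
    (hA : A.IsHermitian) :
    A = (hA.eigenvectorUnitary : Matrix n n ℂ) * Matrix.diagonal (fun i => (hA.eigenvalues i : ℂ)) *
      (hA.eigenvectorUnitary : Matrix n n ℂ)ᴴ := by
  have h := hA.spectral_theorem
  rw [Unitary.conjStarAlgAut_apply] at h
  exact h

theorem Matrix.PosSemidef.exists_conjTranspose_mul_self {A : Matrix n n ℂ} (hA : A.PosSemidef) :
    ∃ B : Matrix n n ℂ, A = Bᴴ * B := by
  classical
  refine ⟨Matrix.diagonal (fun i => ((Real.sqrt (hA.1.eigenvalues i) : ℝ) : ℂ)) *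
    (hA.1.eigenvectorUnitary : Matrix n n ℂ)ᴴ, ?_⟩
  conv_lhs => rw [hA.1.eq_mul_diagonal_mul]
  rw [Matrix.conjTranspose_mul, Matrix.conjTranspose_conjTranspose, Matrix.diagonal_conjTranspose,
    Matrix.mul_assoc, Matrix.mul_assoc, ← Matrix.mul_assoc (Matrix.diagonal _) (Matrix.diagonal _),
    Matrix.diagonal_mul_diagonal]
  congr 3
  ext i
  simp only [Pi.star_apply, Complex.star_def, Complex.conj_ofReal]
  rw [← Complex.ofReal_mul, Real.mul_self_sqrt (hA.eigenvalues_nonneg i)]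

theorem rankOne_apply {n : Type} (x : n → ℂ) (i j : n) : rankOne x i j = x i * star (x j) := rfl

theorem posSemidef_rankOne (x : n → ℂ) : (rankOne x).PosSemidef :=
  Matrix.posSemidef_vecMulVec_self_star x

theorem trace_rankOne (x : n → ℂ) : (rankOne x).trace = ∑ i, x i * star (x i) := rfl

theorem trace_mul_rankOne (A : Matrix n n ℂ) (x : n → ℂ) :
    (A * rankOne x).trace = star x ⬝ᵥ (A *ᵥ x) := by
  rw [rankOne, Matrix.mul_vecMulVec, Matrix.trace_vecMulVec, dotProduct_comm]

theorem Matrix.PosSemidef.exists_eq_sum_rankOne {A : Matrix n n ℂ} (hA : A.PosSemidef) :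
    ∃ v : n → n → ℂ, A = ∑ i, rankOne (v i) := by
  obtain ⟨B, rfl⟩ := hA.exists_conjTranspose_mul_self
  refine ⟨fun i j => star (B i j), ?_⟩
  ext i j
  simp [Matrix.mul_apply, Matrix.sum_apply, rankOne_apply]

theorem Matrix.posSemidef_of_dotProduct_mulVec {A : Matrix n n ℂ}
    (h : ∀ x, 0 ≤ star x ⬝ᵥ (A *ᵥ x)) : A.PosSemidef := by
  classical
  rw [← Matrix.isPositive_toEuclideanLin_iff, LinearMap.isPositive_iff_complex]
  intro x
  have hx := h x.ofLp
  have e : inner ℂ (Matrix.toEuclideanLin A x) x = star (star x.ofLp ⬝ᵥ (A *ᵥ x.ofLp)) := by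
    rw [EuclideanSpace.inner_eq_star_dotProduct, Matrix.star_dotProduct, star_star, dotProduct_comm]
    rfl
  rw [e, (IsSelfAdjoint.of_nonneg hx).star_eq]
  obtain ⟨h1, h2⟩ := Complex.le_def.1 hx
  exact ⟨Complex.ext rfl h2, h1⟩

theorem Matrix.PosSemidef.trace_mul_nonneg {A B : Matrix n n ℂ} (hA : A.PosSemidef)
    (hB : B.PosSemidef) : 0 ≤ (A * B).trace := by
  obtain ⟨v, rfl⟩ := hB.exists_eq_sum_rankOne
  rw [Matrix.mul_sum, Matrix.trace_sum]
  refine Finset.sum_nonneg fun i _ => ?_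
  rw [trace_mul_rankOne]
  exact hA.dotProduct_mulVec_nonneg _

end Matrices

/-! ### The trace norm of Hermitian matrices -/

section TraceNorm

variable {n : Type} [Fintype n] [DecidableEq n]

/-- `Aᴴ * A` is unitarily similar to the diagonal matrix of squared eigenvalues, so both have the
same characteristic polynomial; comparing multisets of roots avoids matching the two orderings of
eigenvalues. -/
theorem Matrix.IsHermitian.traceNorm_eq {A : Matrix n n ℂ} (hA : A.IsHermitian) :
    traceNorm A = ∑ i, |hA.eigenvalues i| := by
  have hU : (hA.eigenvectorUnitary : Matrix n n ℂ)ᴴ * (hA.eigenvectorUnitary : Matrix n n ℂ) = 1 :=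
    Unitary.coe_star_mul_self hA.eigenvectorUnitary
  have h1 : Aᴴ * A = (hA.eigenvectorUnitary : Matrix n n ℂ) *
      Matrix.diagonal (fun i => ((hA.eigenvalues i ^ 2 : ℝ) : ℂ)) *
      (hA.eigenvectorUnitary : Matrix n n ℂ)ᴴ := by
    rw [hA.eq]
    conv_lhs => rw [hA.eq_mul_diagonal_mul]
    simp only [Matrix.mul_assoc]
    rw [← Matrix.mul_assoc (_ᴴ) _ (_ * _), hU, Matrix.one_mul,
      ← Matrix.mul_assoc (Matrix.diagonal _), Matrix.diagonal_mul_diagonal]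
    congr 3
    ext i
    push_cast
    ring
  have h2 : (Aᴴ * A).charpoly =
      (Matrix.diagonal (fun i => ((hA.eigenvalues i ^ 2 : ℝ) : ℂ))).charpoly := by
    rw [h1, Matrix.charpoly_mul_comm, ← Matrix.mul_assoc, hU, Matrix.one_mul]
  have h3 := (Matrix.isHermitian_conjTranspose_mul_self A).roots_charpoly_eq_eigenvalues
  rw [h2, Matrix.charpoly_diagonal, Polynomial.roots_prod _ _
    (Finset.prod_ne_zero_iff.2 fun i _ => Polynomial.X_sub_C_ne_zero _)] at h3
  have h4 := congrArg (fun s => (s.map fun z : ℂ => Real.sqrt z.re).sum) h3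
  simp only [Polynomial.roots_X_sub_C, Multiset.bind_singleton, Multiset.map_map] at h4
  simp only [Function.comp_def, Complex.ofReal_re, RCLike.ofReal_eq_complex_ofReal,
    Real.sqrt_sq_eq_abs] at h4
  exact h4.symm

theorem Matrix.PosSemidef.traceNorm_eq {A : Matrix n n ℂ} (hA : A.PosSemidef) :
    (traceNorm A : ℂ) = A.trace := by
  rw [hA.1.traceNorm_eq, hA.1.trace_eq_sum_eigenvalues]
  push_cast
  refine Finset.sum_congr rfl fun i _ => ?_
  rw [abs_of_nonneg (hA.eigenvalues_nonneg i)]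
  rfl

/-- Jordan decomposition. With `traceNorm_sub_le` it characterises the trace norm as the least value
of `P.trace + N.trace` over positive decompositions. -/
theorem Matrix.IsHermitian.exists_eq_sub {A : Matrix n n ℂ} (hA : A.IsHermitian) :
    ∃ P N : Matrix n n ℂ, P.PosSemidef ∧ N.PosSemidef ∧ A = P - N ∧
      P.trace + N.trace = (traceNorm A : ℂ) := by
  have hU : (hA.eigenvectorUnitary : Matrix n n ℂ)ᴴ * (hA.eigenvectorUnitary : Matrix n n ℂ) = 1 :=
    Unitary.coe_star_mul_self hA.eigenvectorUnitary
  have hd : ∀ f : n → ℝ, (∀ i, 0 ≤ f i) → ((hA.eigenvectorUnitary : Matrix n n ℂ) *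
      Matrix.diagonal (fun i => (f i : ℂ)) * (hA.eigenvectorUnitary : Matrix n n ℂ)ᴴ).PosSemidef :=
    fun f hf => (Matrix.PosSemidef.diagonal fun i => by
      simpa using hf i).mul_mul_conjTranspose_same _
  refine ⟨_, _, hd (fun i => (hA.eigenvalues i)⁺) fun i => posPart_nonneg _,
    hd (fun i => (hA.eigenvalues i)⁻) fun i => negPart_nonneg _, ?_, ?_⟩
  · conv_lhs => rw [hA.eq_mul_diagonal_mul]
    rw [← Matrix.sub_mul, ← Matrix.mul_sub, Matrix.diagonal_sub]
    congr 3
    ext i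
    rw [← Complex.ofReal_sub, posPart_sub_negPart]
  · rw [← Matrix.trace_add, ← Matrix.add_mul, ← Matrix.mul_add, Matrix.diagonal_add,
      Matrix.trace_mul_comm, ← Matrix.mul_assoc, hU, Matrix.one_mul, Matrix.trace_diagonal,
      hA.traceNorm_eq]
    push_cast
    refine Finset.sum_congr rfl fun i _ => ?_
    rw [← Complex.ofReal_add, posPart_add_negPart]

/-- On each eigenvector `v` of `P - N`, `|⟨v, (P - N) v⟩| ≤ ⟨v, (P + N) v⟩`; summing over the
eigenbasis gives the trace on the right. -/
theorem traceNorm_sub_le {P N : Matrix n n ℂ} (hP : P.PosSemidef) (hN : N.PosSemidef) :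
    traceNorm (P - N) ≤ (P.trace + N.trace).re := by
  have hA : (P - N).IsHermitian := hP.1.sub hN.1
  rw [hA.traceNorm_eq, ← Matrix.trace_add]
  set U := (hA.eigenvectorUnitary : Matrix n n ℂ) with hUdef
  have hU : U * Uᴴ = 1 := Unitary.coe_mul_star_self hA.eigenvectorUnitary
  have htr : (P + N).trace = ∑ i, star (hA.eigenvectorBasis i).ofLp ⬝ᵥ
      ((P + N) *ᵥ (hA.eigenvectorBasis i).ofLp) := by
    have : (P + N).trace = (Uᴴ * (P + N) * U).trace := by
      rw [Matrix.trace_mul_comm, ← Matrix.mul_assoc, hU, Matrix.one_mul]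
    rw [this, Matrix.trace]
    refine Finset.sum_congr rfl fun i _ => ?_
    rw [Matrix.diag_apply, Matrix.mul_assoc]
    rfl
  rw [htr, Complex.re_sum]
  refine Finset.sum_le_sum fun i _ => ?_
  rw [hA.eigenvalues_eq, Matrix.sub_mulVec, Matrix.add_mulVec, dotProduct_sub, dotProduct_add]
  have h1 := (Complex.le_def.1 (hP.dotProduct_mulVec_nonneg (hA.eigenvectorBasis i).ofLp)).1
  have h2 := (Complex.le_def.1 (hN.dotProduct_mulVec_nonneg (hA.eigenvectorBasis i).ofLp)).1
  simp only [Complex.zero_re] at h1 h2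
  simp only [RCLike.re_eq_complex_re, Complex.sub_re, Complex.add_re]
  exact abs_le.2 ⟨by linarith, by linarith⟩

end TraceNorm

/-! ### Completely positive maps -/

namespace SuperOp

variable {a a' b b' n k l : Type}

theorem onLeft_apply (E : SuperOp a a') (b : Type) (X : Matrix (a × b) (a × b) ℂ) (p q : a' × b) :
    E.onLeft b X p q = E (Matrix.of fun i j => X (i, p.2) (j, q.2)) p.1 q.1 := rfl

theorem onRight_apply (D : SuperOp b b') (a : Type) (X : Matrix (a × b) (a × b) ℂ)
    (p q : a × b') :
    D.onRight a X p q = D (Matrix.of fun i j => X (p.1, i) (q.1, j)) p.2 q.2 := rfl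

theorem IsCP.posSemidef_onRight {Λ : SuperOp n k} (h : Λ.IsCP) {r : Type} [Fintype r]
    {X : Matrix (r × n) (r × n) ℂ} (hX : X.PosSemidef) : (Λ.onRight r X).PosSemidef := by
  let e := Fintype.equivFin r
  have h1 := (h _ _ (hX.submatrix (Prod.map e.symm id))).submatrix (Prod.map e id)
  convert h1 using 1
  ext p q
  simp only [Matrix.submatrix_apply, onRight_apply, Prod.map_fst, Prod.map_snd, Prod.map_apply,
    Equiv.symm_apply_apply, id]

theorem IsCP.posSemidef {Λ : SuperOp n k} (h : Λ.IsCP) {X : Matrix n n ℂ} (hX : X.PosSemidef) :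
    (Λ X).PosSemidef :=
  (h.posSemidef_onRight (r := Unit) (hX.submatrix Prod.snd)).submatrix (fun i => ((), i))

theorem IsCP.onRight [Fintype a] {D : SuperOp b b'} (h : D.IsCP) : (D.onRight a).IsCP := by
  intro r X hX
  exact (h.posSemidef_onRight (hX.submatrix (Equiv.prodAssoc (Fin r) a b))).submatrix
    (Equiv.prodAssoc (Fin r) a b').symm

theorem IsCP.onLeft [Fintype b] {E : SuperOp a a'} (h : E.IsCP) : (E.onLeft b).IsCP := by
  intro r X hX
  exact (h.posSemidef_onRight (r := Fin r × b)
    (hX.submatrix fun p : (Fin r × b) × a => (p.1.1, (p.2, p.1.2)))).submatrix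
    fun p : Fin r × (a' × b) => ((p.1, p.2.2), p.2.1)

theorem IsCP.comp {Λ : SuperOp k l} {Φ : SuperOp n k} (hΛ : Λ.IsCP) (hΦ : Φ.IsCP) :
    SuperOp.IsCP (LinearMap.comp Λ Φ) :=
  fun r X hX => hΛ r _ (hΦ r X hX)

theorem IsCP.zero : SuperOp.IsCP (0 : SuperOp n k) := fun _ _ _ => Matrix.PosSemidef.zero

theorem IsCP.add {Λ Φ : SuperOp n k} (hΛ : Λ.IsCP) (hΦ : Φ.IsCP) :
    SuperOp.IsCP (Λ + Φ) :=
  fun r X hX => (hΛ r X hX).add (hΦ r X hX)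

theorem IsCP.smul {Λ : SuperOp n k} (hΛ : Λ.IsCP) {t : ℝ} (ht : 0 ≤ t) :
    SuperOp.IsCP ((t : ℂ) • Λ) :=
  fun r X hX => (hΛ r X hX).smul (Complex.zero_le_real.2 ht)

theorem IsCP.sum {ι : Type} {s : Finset ι} {Λ : ι → SuperOp n k} (h : ∀ i ∈ s, (Λ i).IsCP) :
    SuperOp.IsCP (∑ i ∈ s, Λ i) := by
  classical
  induction s using Finset.induction_on with
  | empty => exact IsCP.zero
  | insert i s hi ih =>
    rw [Finset.sum_insert hi]
    exact (h i (Finset.mem_insert_self i s)).add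
      (ih fun j hj => h j (Finset.mem_insert_of_mem hj))

theorem IsCP.tensor [Fintype a] [Fintype b'] {E : SuperOp a a'} {D : SuperOp b b'} (hE : E.IsCP)
    (hD : D.IsCP) : (E.tensor D).IsCP :=
  hE.onLeft.comp hD.onRight

/-- The map `X ↦ K X Kᴴ`. -/
def conj [Fintype n] (K : Matrix k n ℂ) : SuperOp n k where
  toFun X := K * X * Kᴴ
  map_add' X Y := by rw [Matrix.mul_add, Matrix.add_mul]
  map_smul' z X := by simp

theorem conj_apply [Fintype n] (K : Matrix k n ℂ) (X : Matrix n n ℂ) :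
    conj K X = K * X * Kᴴ := rfl

theorem conj_onRight_rankOne [Fintype n] (K : Matrix k n ℂ) {r : Type} (v : r × n → ℂ) :
    (conj K).onRight r (rankOne v) =
      rankOne fun p : r × k => (K *ᵥ fun j => v (p.1, j)) p.2 := by
  ext p q
  rw [onRight_apply, conj_apply, rankOne_apply]
  have : (Matrix.of fun j j' => rankOne v (p.1, j) (q.1, j')) =
      Matrix.vecMulVec (fun j => v (p.1, j)) (star fun j => v (q.1, j)) := rfl
  rw [this, Matrix.mul_vecMulVec, Matrix.vecMulVec_mul, ← Matrix.star_mulVec]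
  rfl

theorem conj_onLeft_rankOne [Fintype n] (K : Matrix k n ℂ) {r : Type} (v : n × r → ℂ) :
    (conj K).onLeft r (rankOne v) =
      rankOne fun p : k × r => (K *ᵥ fun j => v (j, p.2)) p.1 := by
  ext p q
  rw [onLeft_apply, conj_apply, rankOne_apply]
  have : (Matrix.of fun j j' => rankOne v (j, p.2) (j', q.2)) =
      Matrix.vecMulVec (fun j => v (j, p.2)) (star fun j => v (j, q.2)) := rfl
  rw [this, Matrix.mul_vecMulVec, Matrix.vecMulVec_mul, ← Matrix.star_mulVec]
  rfl

theorem isCP_conj [Fintype n] [Finite k] (K : Matrix k n ℂ) : (conj K).IsCP := by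
  have := Fintype.ofFinite k
  intro r X hX
  obtain ⟨v, rfl⟩ := hX.exists_eq_sum_rankOne
  rw [map_sum]
  refine Matrix.posSemidef_sum _ fun i _ => ?_
  rw [conj_onRight_rankOne]
  exact posSemidef_rankOne _

theorem isCP_id : SuperOp.IsCP (LinearMap.id : SuperOp n n) := fun _ _ hX => hX

theorem apply_eq_sum [Fintype n] [DecidableEq n] (Λ : SuperOp n k) (X : Matrix n n ℂ) (p q : k) :
    Λ X p q = ∑ i, ∑ j, X i j * Λ (Matrix.single i j 1) p q := by
  conv_lhs => rw [Matrix.matrix_eq_sum_single X]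
  simp only [map_sum, Matrix.sum_apply]
  refine Finset.sum_congr rfl fun i _ => Finset.sum_congr rfl fun j _ => ?_
  rw [← mul_one (X i j), ← smul_eq_mul, ← Matrix.smul_single, map_smul]
  simp

/-- Both orders expand over matrix units to the same fourfold sum. -/
theorem onLeft_comp_onRight_comm [Fintype a] [Fintype b] (E : SuperOp a a') (D : SuperOp b b') :
    (E.onLeft b').comp (D.onRight a) = (D.onRight a').comp (E.onLeft b) := by
  classical
  ext X p q
  rw [LinearMap.comp_apply, LinearMap.comp_apply, onLeft_apply, onRight_apply, E.apply_eq_sum,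
    D.apply_eq_sum]
  simp only [Matrix.of_apply, onLeft_apply, onRight_apply]
  simp_rw [D.apply_eq_sum (Matrix.of fun i j => X (_, i) (_, j)),
    E.apply_eq_sum (Matrix.of fun i j => X (i, _) (j, _)), Matrix.of_apply, Finset.sum_mul]
  rw [← Fintype.sum_prod_type', ← Fintype.sum_prod_type']
  simp_rw [← Fintype.sum_prod_type']
  exact Fintype.sum_equiv ⟨fun x => (x.1.2, x.2, x.1.1), fun y => ((y.2.2, y.1), y.2.1),
    fun _ => rfl, fun _ => rfl⟩ _ _ fun _ => mul_right_comm _ _ _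

theorem tensor_eq_comp [Fintype a] [Fintype b] (E : SuperOp a a') (D : SuperOp b b') :
    E.tensor D = (D.onRight a').comp (E.onLeft b) :=
  onLeft_comp_onRight_comm E D

theorem trace_onLeft [Fintype a'] [Fintype b] (E : SuperOp a a') (X : Matrix (a × b) (a × b) ℂ) :
    (E.onLeft b X).trace = ∑ i, (E (Matrix.of fun p q => X (p, i) (q, i))).trace := by
  simp only [Matrix.trace, Fintype.sum_prod_type_right]
  rfl

theorem trace_onRight [Fintype a] [Fintype b'] (D : SuperOp b b') (X : Matrix (a × b) (a × b) ℂ) :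
    (D.onRight a X).trace = ∑ i, (D (Matrix.of fun p q => X (i, p) (i, q))).trace := by
  simp only [Matrix.trace, Fintype.sum_prod_type]
  rfl

/-- The map `X ↦ (D Xᵀ)ᵀ`. -/
def transposed (D : SuperOp b b') : SuperOp b b' where
  toFun X := (D Xᵀ)ᵀ
  map_add' X Y := by simp
  map_smul' z X := by simp

/-- The amplification of `D.transposed` is that of `D` between two full transposes, which preserve
positivity. -/
theorem IsCP.transposed {D : SuperOp b b'} (h : D.IsCP) : D.transposed.IsCP :=
  fun r _ hX => (h r _ hX.transpose).transpose

theorem trace_partialTranspose [Fintype a] [Fintype b] (X : Matrix (a × b) (a × b) ℂ) :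
    (partialTranspose a b X).trace = X.trace := rfl

end SuperOp

/-! ### Trace preservation by local operations -/

theorem IsInstrument.sum_trace_onLeft {n N : ℕ} {k : Fin N → ℕ} {b : Type} [Fintype b]
    {E : ∀ j, SuperOp (Fin n) (Fin (k j))} (hE : IsInstrument E)
    (X : Matrix (Fin n × b) (Fin n × b) ℂ) : ∑ j, ((E j).onLeft b X).trace = X.trace := by
  simp_rw [SuperOp.trace_onLeft]
  rw [Finset.sum_comm]
  simp_rw [hE.2]
  simp only [Matrix.trace, Fintype.sum_prod_type_right]
  rfl

theorem IsInstrument.sum_trace_onRight {n N : ℕ} {k : Fin N → ℕ} {a : Type} [Fintype a]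
    {D : ∀ j, SuperOp (Fin n) (Fin (k j))} (hD : IsInstrument D)
    (X : Matrix (a × Fin n) (a × Fin n) ℂ) : ∑ j, ((D j).onRight a X).trace = X.trace := by
  simp_rw [SuperOp.trace_onRight]
  rw [Finset.sum_comm]
  simp_rw [hD.2]
  simp only [Matrix.trace, Fintype.sum_prod_type]
  rfl

theorem SuperOp.IsCPTP.tensor {a a' b b' : Type} [Fintype a] [Fintype a'] [Fintype b] [Fintype b']
    {E : SuperOp a a'} {D : SuperOp b b'} (hE : E.IsCPTP) (hD : D.IsCPTP) :
    (E.tensor D).IsCPTP := by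
  refine ⟨hE.1.tensor hD.1, fun X => ?_⟩
  rw [SuperOp.tensor, LinearMap.comp_apply, SuperOp.trace_onLeft]
  simp_rw [hE.2]
  have : ∀ Y : Matrix (a × b') (a × b') ℂ,
      ∑ i, (Matrix.of fun p q => Y (p, i) (q, i)).trace = Y.trace := fun Y => by
    simp only [Matrix.trace, Fintype.sum_prod_type_right]
    rfl
  rw [this, SuperOp.trace_onRight]
  simp_rw [hD.2]
  simp only [Matrix.trace, Fintype.sum_prod_type]
  rfl

/-! ### Inclusions between the classes of operations -/

theorem IsOneWayLOCC.isLOCC {a b a' b' : ℕ} {Λ : SuperOp (Fin a × Fin b) (Fin a' × Fin b')}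
    (h : IsOneWayLOCC Λ) : IsLOCC Λ := by
  obtain ⟨N, E, D, hE, hD, rfl⟩ := h
  have h1 : ∀ j, (E j).tensor (D j) =
      LinearMap.comp (SuperOp.tensor (LinearMap.id : SuperOp (Fin a') (Fin a')) (D j))
        ((E j).onLeft (Fin b)) := fun j => (E j).tensor_eq_comp (D j)
  simp_rw [h1]
  exact IsLOCC.alice (fun _ => a') E _ hE fun j =>
    IsLOCC.localOps _ _ ⟨SuperOp.isCP_id, fun _ => rfl⟩ (hD j)

theorem IsLOCC.isCPTP {a b a' b' : ℕ} {Λ : SuperOp (Fin a × Fin b) (Fin a' × Fin b')}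
    (h : IsLOCC Λ) : Λ.IsCPTP := by
  induction h with
  | localOps E D hE hD => exact hE.tensor hD
  | alice c E Λ hE _ ih =>
    refine ⟨SuperOp.IsCP.sum fun j _ => (ih j).1.comp (hE.1 j).onLeft, fun X => ?_⟩
    rw [LinearMap.sum_apply, Matrix.trace_sum, ← hE.sum_trace_onLeft X]
    exact Finset.sum_congr rfl fun j _ => (ih j).2 _
  | bob c D Λ hD _ ih =>
    refine ⟨SuperOp.IsCP.sum fun j _ => (ih j).1.comp (hD.1 j).onRight, fun X => ?_⟩
    rw [LinearMap.sum_apply, Matrix.trace_sum, ← hD.sum_trace_onRight X]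
    exact Finset.sum_congr rfl fun j _ => (ih j).2 _

/-- The map `Λ` conjugated by the partial transposes. -/
abbrev SuperOp.ptConj {a b a' b' : Type} (Λ : SuperOp (a × b) (a' × b')) :
    SuperOp (a × b) (a' × b') :=
  (partialTranspose a' b').comp (Λ.comp (partialTranspose a b))

theorem SuperOp.ptConj_sum {a b a' b' ι : Type} [Fintype ι] (Λ : ι → SuperOp (a × b) (a' × b')) :
    SuperOp.ptConj (∑ i, Λ i) = ∑ i, (Λ i).ptConj := by
  ext X : 1
  simp [SuperOp.ptConj, LinearMap.sum_apply]

theorem SuperOp.ptConj_comp_onLeft {a a₁ b a' b' : Type} (Λ : SuperOp (a₁ × b) (a' × b'))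
    (E : SuperOp a a₁) :
    SuperOp.ptConj (Λ.comp (E.onLeft b)) = Λ.ptConj.comp (E.onLeft b) :=
  LinearMap.ext fun _ => rfl

/-- Moving the partial transpose past an operation of Bob replaces `D` by `D.transposed`; operations
of Alice commute with it. This drives the induction over LOCC rounds. -/
theorem SuperOp.ptConj_comp_onRight {a b b₁ a' b' : Type} (Λ : SuperOp (a × b₁) (a' × b'))
    (D : SuperOp b b₁) :
    SuperOp.ptConj (Λ.comp (D.onRight a)) = Λ.ptConj.comp (D.transposed.onRight a) :=
  LinearMap.ext fun _ => rfl

theorem SuperOp.ptConj_tensor {a b a' b' : Type} (E : SuperOp a a') (D : SuperOp b b') :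
    (E.tensor D).ptConj = E.tensor D.transposed :=
  LinearMap.ext fun _ => rfl

theorem IsLOCC.isCP_ptConj {a b a' b' : ℕ} {Λ : SuperOp (Fin a × Fin b) (Fin a' × Fin b')}
    (h : IsLOCC Λ) : Λ.ptConj.IsCP := by
  induction h with
  | localOps E D hE hD =>
    rw [SuperOp.ptConj_tensor]
    exact hE.1.tensor hD.1.transposed
  | alice c E Λ hE _ ih =>
    rw [SuperOp.ptConj_sum]
    refine SuperOp.IsCP.sum fun j _ => ?_
    rw [SuperOp.ptConj_comp_onLeft]
    exact (ih j).comp (hE.1 j).onLeft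
  | bob c D Λ hD _ ih =>
    rw [SuperOp.ptConj_sum]
    refine SuperOp.IsCP.sum fun j _ => ?_
    rw [SuperOp.ptConj_comp_onRight]
    exact (ih j).comp (hD.1 j).transposed.onRight

theorem IsLOCC.mem_ppt {a b a' b' : ℕ} {Λ : SuperOp (Fin a × Fin b) (Fin a' × Fin b')}
    (h : IsLOCC Λ) : Λ ∈ OpClass.PPT.ops a b a' b' :=
  ⟨h.isCPTP, h.isCP_ptConj⟩

theorem ops_ppt_subset_pptPreserving {a b a' b' : ℕ} :
    OpClass.PPT.ops a b a' b' ⊆ OpClass.pptPreserving.ops a b a' b' := by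
  rintro Λ ⟨hΛ, hT⟩
  exact ⟨hΛ, fun X hX => ⟨(hΛ.2 X).trans hX.1, hΛ.1.posSemidef hX.2.1,
    SuperOp.IsCP.posSemidef hT hX.2.2⟩⟩

theorem isHermitian_partialTranspose {a b : Type} {X : Matrix (a × b) (a × b) ℂ}
    (hX : X.IsHermitian) : (partialTranspose a b X).IsHermitian := by
  ext p q
  exact congrFun (congrFun hX (p.1, q.2)) (q.1, p.2)

/-- `Λ.ptConj` is positive and trace preserving, so it carries the Jordan decomposition of the
partial transpose of `X` to a decomposition of the same total trace. -/
theorem ops_ppt_subset_rainsPreserving {a b a' b' : ℕ} :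
    OpClass.PPT.ops a b a' b' ⊆ OpClass.rainsPreserving.ops a b a' b' := by
  rintro Λ ⟨hΛ, hT⟩
  refine ⟨hΛ, fun X hX => ⟨hΛ.1.posSemidef hX.1, ?_⟩⟩
  obtain ⟨P, N, hP, hN, hPN, htr⟩ := (isHermitian_partialTranspose hX.1.1).exists_eq_sub
  have h1 : partialTranspose _ _ (Λ X) = Λ.ptConj P - Λ.ptConj N := by
    rw [← map_sub, ← hPN]
    rfl
  have h2 : ∀ Y, (Λ.ptConj Y).trace = Y.trace := fun Y => hΛ.2 _
  rw [h1]
  refine (traceNorm_sub_le (SuperOp.IsCP.posSemidef hT hP)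
    (SuperOp.IsCP.posSemidef hT hN)).trans ?_
  rw [h2, h2, htr, Complex.ofReal_re]
  exact hX.2

/-! #### The cone of separable operators -/

/-- The cone generated by the rank-one operators of product vectors. -/
def separableCone (a b : Type) : AddSubmonoid (Matrix (a × b) (a × b) ℂ) :=
  AddSubmonoid.closure {X | ∃ (φ : a → ℂ) (η : b → ℂ), X = rankOne fun p => φ p.1 * η p.2}

theorem rankOne_mul_mem_separableCone {a b : Type} (φ : a → ℂ) (η : b → ℂ) :
    (rankOne fun p : a × b => φ p.1 * η p.2) ∈ separableCone a b :=
  AddSubmonoid.subset_closure ⟨φ, η, rfl⟩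

/-- Single branches of an instrument do not preserve the trace, so the induction over LOCC protocols
runs on the unnormalised cone and normalises only at the end. -/
theorem onLeft_mem_separableCone {a a' b : Type} [Fintype a] [Fintype a'] [Fintype b]
    {E : SuperOp a a'} (hE : E.IsCP) {X : Matrix (a × b) (a × b) ℂ} (hX : X ∈ separableCone a b) :
    E.onLeft b X ∈ separableCone a' b := by
  induction hX using AddSubmonoid.closure_induction with
  | zero => simp
  | add X Y _ _ h1 h2 => rw [map_add]; exact add_mem h1 h2
  | mem X hX =>
    obtain ⟨φ, η, rfl⟩ := hX
    obtain ⟨v, hv⟩ := (hE.posSemidef (posSemidef_rankOne φ)).exists_eq_sum_rankOne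
    have : E.onLeft b (rankOne fun p => φ p.1 * η p.2) =
        ∑ i, rankOne fun p : a' × b => v i p.1 * η p.2 := by
      ext p q
      have h1 : (Matrix.of fun i j => (rankOne fun p : a × b => φ p.1 * η p.2) (i, p.2) (j, q.2)) =
          (η p.2 * star (η q.2)) • rankOne φ := by
        ext i j
        simp [rankOne_apply]
        ring
      rw [SuperOp.onLeft_apply, h1, map_smul, hv, Matrix.smul_apply, Matrix.sum_apply,
        Matrix.sum_apply, Finset.smul_sum]
      refine Finset.sum_congr rfl fun i _ => ?_
      simp [rankOne_apply]
      ring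
    rw [this]
    exact sum_mem fun i _ => rankOne_mul_mem_separableCone _ _

theorem onRight_mem_separableCone {a b b' : Type} [Fintype a] [Fintype b] [Fintype b']
    {D : SuperOp b b'} (hD : D.IsCP) {X : Matrix (a × b) (a × b) ℂ} (hX : X ∈ separableCone a b) :
    D.onRight a X ∈ separableCone a b' := by
  induction hX using AddSubmonoid.closure_induction with
  | zero => simp
  | add X Y _ _ h1 h2 => rw [map_add]; exact add_mem h1 h2
  | mem X hX =>
    obtain ⟨φ, η, rfl⟩ := hX
    obtain ⟨v, hv⟩ := (hD.posSemidef (posSemidef_rankOne η)).exists_eq_sum_rankOne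
    have : D.onRight a (rankOne fun p => φ p.1 * η p.2) =
        ∑ i, rankOne fun p : a × b' => φ p.1 * v i p.2 := by
      ext p q
      have h1 : (Matrix.of fun i j => (rankOne fun p : a × b => φ p.1 * η p.2) (p.1, i) (q.1, j)) =
          (φ p.1 * star (φ q.1)) • rankOne η := by
        ext i j
        simp [rankOne_apply]
        ring
      rw [SuperOp.onRight_apply, h1, map_smul, hv, Matrix.smul_apply, Matrix.sum_apply,
        Matrix.sum_apply, Finset.smul_sum]
      refine Finset.sum_congr rfl fun i _ => ?_
      simp [rankOne_apply]
      ring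
    rw [this]
    exact sum_mem fun i _ => rankOne_mul_mem_separableCone _ _

theorem IsLOCC.mem_separableCone {a b a' b' : ℕ} {Λ : SuperOp (Fin a × Fin b) (Fin a' × Fin b')}
    (h : IsLOCC Λ) {X} (hX : X ∈ separableCone (Fin a) (Fin b)) :
    Λ X ∈ separableCone (Fin a') (Fin b') := by
  induction h with
  | localOps E D hE hD =>
    exact onLeft_mem_separableCone hE.1 (onRight_mem_separableCone hD.1 hX)
  | alice c E Λ hE _ ih =>
    rw [LinearMap.sum_apply]
    exact sum_mem fun j _ => ih j (onLeft_mem_separableCone (hE.1 j) hX)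
  | bob c D Λ hD _ ih =>
    rw [LinearMap.sum_apply]
    exact sum_mem fun j _ => ih j (onRight_mem_separableCone (hD.1 j) hX)

theorem sum_mul_star_eq_norm_sq {n : Type} [Fintype n] (x : EuclideanSpace ℂ n) :
    ∑ i, x i * star (x i) = ((‖x‖ ^ 2 : ℝ) : ℂ) := by
  rw [EuclideanSpace.norm_sq_eq]
  push_cast
  refine Finset.sum_congr rfl fun i _ => ?_
  rw [Complex.star_def, Complex.mul_conj, Complex.normSq_eq_norm_sq]
  push_cast
  rfl

theorem trace_rankOne_mul {a b : Type} [Fintype a] [Fintype b] (φ : EuclideanSpace ℂ a)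
    (η : EuclideanSpace ℂ b) :
    (rankOne fun p : a × b => φ p.1 * η p.2).trace = ((‖φ‖ ^ 2 * ‖η‖ ^ 2 : ℝ) : ℂ) := by
  rw [Complex.ofReal_mul, ← sum_mul_star_eq_norm_sq, ← sum_mul_star_eq_norm_sq, Finset.sum_mul_sum,
    trace_rankOne, Fintype.sum_prod_type]
  refine Finset.sum_congr rfl fun i _ => Finset.sum_congr rfl fun j _ => ?_
  rw [star_mul']
  ring

theorem rankOne_smul {n : Type} (t : ℝ) (x : n → ℂ) :
    rankOne ((t : ℂ) • x) = (t ^ 2) • rankOne x := by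
  ext i j
  simp [rankOne_apply]
  ring

theorem convex_separableStates (a b : ℕ) : Convex ℝ (separableStates a b) := convex_convexHull _ _

theorem separableStates_subset_cone {a b : ℕ} :
    separableStates a b ⊆ {X | X ∈ separableCone (Fin a) (Fin b) ∧ X.trace = 1} := by
  refine convexHull_min ?_ ?_
  · rintro X ⟨φ, η, hφ, hη, rfl⟩
    refine ⟨rankOne_mul_mem_separableCone _ _, ?_⟩
    rw [trace_rankOne_mul, hφ, hη]
    simp
  · have hs : ∀ {t : ℝ}, 0 ≤ t → ∀ {X : Matrix (Fin a × Fin b) (Fin a × Fin b) ℂ},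
        X ∈ separableCone (Fin a) (Fin b) → t • X ∈ separableCone (Fin a) (Fin b) := by
      intro t ht X hX
      induction hX using AddSubmonoid.closure_induction with
      | zero => simp
      | add X Y _ _ h1 h2 => rw [smul_add]; exact add_mem h1 h2
      | mem X hX =>
        obtain ⟨φ, η, rfl⟩ := hX
        rw [← Real.sq_sqrt ht, ← rankOne_smul]
        have := rankOne_mul_mem_separableCone (((√t : ℝ) : ℂ) • φ) η
        convert this using 2
        ext p
        simp [mul_assoc]
    intro X hX Y hY s t hs0 ht0 hst
    refine ⟨add_mem (hs hs0 hX.1) (hs ht0 hY.1), ?_⟩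
    rw [Matrix.trace_add, Matrix.trace_smul, Matrix.trace_smul, hX.2, hY.2, ← add_smul, hst,
      one_smul]

theorem eq_zero_or_eq_smul_of_mem_separableCone {a b : ℕ}
    {X : Matrix (Fin a × Fin b) (Fin a × Fin b) ℂ} (hX : X ∈ separableCone (Fin a) (Fin b)) :
    X = 0 ∨ ∃ t : ℝ, 0 < t ∧ ∃ σ ∈ separableStates a b, X = t • σ := by
  induction hX using AddSubmonoid.closure_induction with
  | zero => exact Or.inl rfl
  | add X Y _ _ h1 h2 =>
    rcases h1 with rfl | ⟨s, hs, σ, hσ, rfl⟩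
    · simpa using h2
    rcases h2 with rfl | ⟨t, ht, τ, hτ, rfl⟩
    · exact Or.inr ⟨s, hs, σ, hσ, add_zero _⟩
    have hst : 0 < s + t := by positivity
    refine Or.inr ⟨s + t, hst, (s / (s + t)) • σ + (t / (s + t)) • τ,
      convex_separableStates a b hσ hτ (by positivity) (by positivity) (by field_simp), ?_⟩
    rw [smul_add, smul_smul, smul_smul, mul_div_cancel₀ _ hst.ne', mul_div_cancel₀ _ hst.ne']
  | mem X hX =>
    obtain ⟨φ, η, rfl⟩ := hX
    set φ' : EuclideanSpace ℂ (Fin a) := WithLp.toLp 2 φ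
    set η' : EuclideanSpace ℂ (Fin b) := WithLp.toLp 2 η
    by_cases h1 : φ' = 0
    · left
      have : φ = 0 := congrArg WithLp.ofLp h1
      ext p q
      simp [rankOne_apply, this]
    by_cases h2 : η' = 0
    · left
      have : η = 0 := congrArg WithLp.ofLp h2
      ext p q
      simp [rankOne_apply, this]
    have h1' := norm_pos_iff.2 h1
    have h2' := norm_pos_iff.2 h2
    refine Or.inr ⟨(‖φ'‖ * ‖η'‖) ^ 2, by positivity, _, subset_convexHull ℝ _
      ⟨((‖φ'‖⁻¹ : ℝ) : ℂ) • φ', ((‖η'‖⁻¹ : ℝ) : ℂ) • η', ?_, ?_, rfl⟩, ?_⟩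
    · rw [norm_smul, Complex.norm_real, norm_inv, norm_norm, inv_mul_cancel₀ h1'.ne']
    · rw [norm_smul, Complex.norm_real, norm_inv, norm_norm, inv_mul_cancel₀ h2'.ne']
    · rw [← rankOne_smul]
      congr 1
      ext p
      have e1 : (‖φ'‖ : ℂ) ≠ 0 := by exact_mod_cast h1'.ne'
      have e2 : (‖η'‖ : ℂ) ≠ 0 := by exact_mod_cast h2'.ne'
      simp only [Pi.smul_apply, PiLp.smul_apply, smul_eq_mul]
      push_cast
      field_simp
      rfl

/-- The cone needs only sums, since positive scalars are absorbed into the vectors; normalising each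
generator turns a sum into a multiple of a convex combination. -/
theorem mem_separableStates_iff {a b : ℕ} {X : Matrix (Fin a × Fin b) (Fin a × Fin b) ℂ} :
    X ∈ separableStates a b ↔ X ∈ separableCone (Fin a) (Fin b) ∧ X.trace = 1 := by
  refine ⟨fun h => separableStates_subset_cone h, fun ⟨h, htr⟩ => ?_⟩
  rcases eq_zero_or_eq_smul_of_mem_separableCone h with rfl | ⟨t, ht, σ, hσ, rfl⟩
  · simp at htr
  · rw [Matrix.trace_smul, (separableStates_subset_cone hσ).2] at htr
    have : t = 1 := by simpa using htr
    rwa [this, one_smul]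

theorem IsLOCC.mem_separabilityPreserving {a b a' b' : ℕ}
    {Λ : SuperOp (Fin a × Fin b) (Fin a' × Fin b')} (h : IsLOCC Λ) :
    Λ ∈ OpClass.separabilityPreserving.ops a b a' b' := by
  refine ⟨h.isCPTP, fun X hX => ?_⟩
  rw [mem_separableStates_iff] at hX ⊢
  exact ⟨h.mem_separableCone hX.1, (h.isCPTP.2 X).trans hX.2⟩

/-- One-way LOCC is the smallest class, so achievability is needed only there. -/
theorem IsOneWayLOCC.mem_ops {a b a' b' : ℕ} {Λ : SuperOp (Fin a × Fin b) (Fin a' × Fin b')}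
    (h : IsOneWayLOCC Λ) (O : OpClass) : Λ ∈ O.ops a b a' b' := by
  cases O with
  | oneWayLOCC => exact h
  | LOCC => exact h.isLOCC
  | PPT => exact h.isLOCC.mem_ppt
  | rainsPreserving => exact ops_ppt_subset_rainsPreserving h.isLOCC.mem_ppt
  | pptPreserving => exact ops_ppt_subset_pptPreserving h.isLOCC.mem_ppt
  | separabilityPreserving => exact h.isLOCC.mem_separabilityPreserving

/-! ### Overlap with the maximally entangled state -/

theorem separableStates_subset_pptStates (a b : ℕ) : separableStates a b ⊆ pptStates a b := by
  refine convexHull_min ?_ ?_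
  · rintro X ⟨φ, η, hφ, hη, rfl⟩
    refine ⟨by rw [trace_rankOne_mul, hφ, hη]; simp, posSemidef_rankOne _, ?_⟩
    have : partialTranspose (Fin a) (Fin b) (rankOne fun p => φ p.1 * η p.2) =
        rankOne fun p => φ p.1 * star (η p.2) := by
      ext p q
      change φ p.1 * η q.2 * star (φ q.1 * η p.2) =
        φ p.1 * star (η p.2) * star (φ q.1 * star (η q.2))
      rw [star_mul', star_mul', star_star]
      ring
    rw [this]
    exact posSemidef_rankOne _
  · have key : ∀ {s : ℝ}, 0 ≤ s → ∀ {X : Matrix (Fin a × Fin b) (Fin a × Fin b) ℂ}, X.PosSemidef →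
        (s • X).PosSemidef := fun hs _ hX => hX.smul hs
    intro X hX Y hY s t hs ht hst
    refine ⟨?_, (key hs hX.2.1).add (key ht hY.2.1), (key hs hX.2.2).add (key ht hY.2.2)⟩
    rw [Matrix.trace_add, Matrix.trace_smul, Matrix.trace_smul, hX.1, hY.1, ← add_smul, hst,
      one_smul]

theorem pptStates_subset_rainsSet (a b : ℕ) : pptStates a b ⊆ rainsSet a b := by
  intro X hX
  refine ⟨hX.2.1, le_of_eq ?_⟩
  have := hX.2.2.traceNorm_eq
  rw [SuperOp.trace_partialTranspose, hX.1] at this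
  exact_mod_cast this

/-- The sum is the trace of `P` times the swap operator, a unitary. On rank-one terms the bound is
the inequality `2 x y ≤ x ^ 2 + y ^ 2`. -/
theorem Matrix.PosSemidef.abs_re_sum_swap_le {n : Type} [Fintype n] {P : Matrix (n × n) (n × n) ℂ}
    (hP : P.PosSemidef) : |(∑ i, ∑ j, P (i, j) (j, i)).re| ≤ P.trace.re := by
  obtain ⟨v, rfl⟩ := hP.exists_eq_sum_rankOne
  have h1 : ∀ w : n × n → ℂ, |(∑ i, ∑ j, rankOne w (i, j) (j, i)).re| ≤ (rankOne w).trace.re := by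
    intro w
    have htr : (rankOne w).trace.re = ∑ i, ∑ j, ‖w (i, j)‖ ^ 2 := by
      rw [trace_rankOne, Complex.re_sum, Fintype.sum_prod_type]
      refine Finset.sum_congr rfl fun i _ => Finset.sum_congr rfl fun j _ => ?_
      rw [Complex.star_def, Complex.mul_conj, Complex.normSq_eq_norm_sq, Complex.ofReal_re]
    have hsym : ∑ i, ∑ j, ‖w (j, i)‖ ^ 2 = ∑ i, ∑ j, ‖w (i, j)‖ ^ 2 := Finset.sum_comm
    have hle : |(∑ i, ∑ j, rankOne w (i, j) (j, i)).re| ≤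
        ∑ i, ∑ j, (‖w (i, j)‖ ^ 2 + ‖w (j, i)‖ ^ 2) / 2 := by
      refine (Complex.abs_re_le_norm _).trans ((norm_sum_le _ _).trans
        (Finset.sum_le_sum fun i _ => (norm_sum_le _ _).trans (Finset.sum_le_sum fun j _ => ?_)))
      rw [rankOne_apply, norm_mul, norm_star]
      nlinarith [sq_nonneg (‖w (i, j)‖ - ‖w (j, i)‖)]
    refine hle.trans (le_of_eq ?_)
    simp_rw [← Finset.sum_div, Finset.sum_add_distrib]
    rw [hsym, htr]
    ring
  have h2 : ∑ i, ∑ j, (∑ k, rankOne (v k)) (i, j) (j, i) =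
      ∑ k, ∑ i, ∑ j, rankOne (v k) (i, j) (j, i) := by
    rw [Finset.sum_comm (s := (Finset.univ : Finset (n × n)))]
    refine Finset.sum_congr rfl fun i _ => ?_
    rw [Finset.sum_comm]
    simp_rw [Matrix.sum_apply]
  rw [h2, Complex.re_sum, Matrix.trace_sum, Complex.re_sum]
  exact (Finset.abs_sum_le_sum_abs _ _).trans (Finset.sum_le_sum fun k _ => h1 (v k))

theorem maxEntangled_apply (m : ℕ) (p q : Fin m × Fin m) :
    maxEntangled m p q = if p.1 = p.2 ∧ q.1 = q.2 then ((1 / m : ℝ) : ℂ) else 0 := by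
  have h : ((1 / √m : ℝ) : ℂ) * ((1 / √m : ℝ) : ℂ) = ((1 / m : ℝ) : ℂ) := by
    rw [← Complex.ofReal_mul, div_mul_div_comm, Real.mul_self_sqrt (Nat.cast_nonneg m), one_mul]
  rw [maxEntangled, rankOne_apply]
  by_cases h1 : p.1 = p.2 <;> by_cases h2 : q.1 = q.2 <;>
    simp only [h1, h2, if_true, if_false, and_true, and_false, and_self, zero_mul, star_zero,
      mul_zero]
  rw [Complex.star_def, Complex.conj_ofReal, h]

/-- The partial transpose is self-adjoint for the trace pairing and takes `Ψ_m` to the swap divided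
by `m`. -/
theorem trace_mul_maxEntangled {m : ℕ} (X : Matrix (Fin m × Fin m) (Fin m × Fin m) ℂ) :
    (X * maxEntangled m).trace =
      ((1 / m : ℝ) : ℂ) * ∑ i, ∑ j, partialTranspose (Fin m) (Fin m) X (i, j) (j, i) := by
  have h : ∀ i j, partialTranspose (Fin m) (Fin m) X (i, j) (j, i) = X (i, i) (j, j) :=
    fun i j => rfl
  simp_rw [h, Matrix.trace, Matrix.diag_apply, Matrix.mul_apply, maxEntangled_apply,
    Fintype.sum_prod_type, Finset.mul_sum]
  simp only [ite_and, mul_ite, mul_zero, Finset.sum_ite_eq, Finset.mem_univ, if_true]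
  refine Finset.sum_congr rfl fun i _ => ?_
  rw [Finset.sum_comm]
  refine Finset.sum_congr rfl fun j _ => ?_
  simp [mul_comm]

theorem re_trace_mul_maxEntangled_le {m : ℕ} {X : Matrix (Fin m × Fin m) (Fin m × Fin m) ℂ}
    (hX : X ∈ rainsSet m m) : (X * maxEntangled m).trace.re ≤ 1 / m := by
  obtain ⟨P, N, hP, hN, hPN, htr⟩ := (isHermitian_partialTranspose hX.1.1).exists_eq_sub
  rw [trace_mul_maxEntangled, Complex.re_ofReal_mul, hPN]
  simp_rw [Matrix.sub_apply, Finset.sum_sub_distrib]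
  have h1 := abs_le.1 hP.abs_re_sum_swap_le
  have h2 := abs_le.1 hN.abs_re_sum_swap_le
  have h3 := congrArg Complex.re htr
  rw [Complex.add_re, Complex.ofReal_re] at h3
  rw [Complex.sub_re]
  have h4 := hX.2
  exact mul_le_of_le_one_right (by positivity) (by linarith)

/-- The only property of the classes that the upper bound uses. It follows from the chain separable
⊆ PPT ⊆ Rains, applied at the input or the output. -/
theorem OpClass.mem_ops {O : OpClass} {a b a' b' : ℕ}
    {Λ : SuperOp (Fin a × Fin b) (Fin a' × Fin b')} (h : Λ ∈ O.ops a b a' b') :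
    Λ.IsCPTP ∧ ∀ X ∈ separableStates a b, Λ X ∈ rainsSet a' b' := by
  have hS := fun {a b X} (hX : X ∈ separableStates a b) => separableStates_subset_pptStates a b hX
  have hP := fun {a b X} (hX : X ∈ pptStates a b) => pptStates_subset_rainsSet a b hX
  have hppt : Λ ∈ OpClass.pptPreserving.ops a b a' b' →
      Λ.IsCPTP ∧ ∀ X ∈ separableStates a b, Λ X ∈ rainsSet a' b' :=
    fun h => ⟨h.1, fun X hX => hP (h.2 X (hS hX))⟩
  cases O with
  | oneWayLOCC => exact hppt (ops_ppt_subset_pptPreserving (IsOneWayLOCC.isLOCC h).mem_ppt)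
  | LOCC => exact hppt (ops_ppt_subset_pptPreserving (IsLOCC.mem_ppt h))
  | PPT => exact hppt (ops_ppt_subset_pptPreserving h)
  | rainsPreserving => exact ⟨h.1, fun X hX => h.2 X (hP (hS hX))⟩
  | pptPreserving => exact hppt h
  | separabilityPreserving => exact ⟨h.1, fun X hX => hP (hS (h.2 X hX))⟩

/-! ### The upper bound on the fidelity -/

theorem dotProduct_star_eq_inner {n : Type} [Fintype n] (x y : EuclideanSpace ℂ n) :
    star x.ofLp ⬝ᵥ y.ofLp = inner ℂ x y := by
  rw [EuclideanSpace.inner_eq_star_dotProduct, dotProduct_comm]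

theorem Matrix.PosSemidef.re_trace_mul_rankOne_le {n : Type} [Fintype n] {A : Matrix n n ℂ}
    (hA : A.PosSemidef) {u : EuclideanSpace ℂ n} (hu : ‖u‖ ≤ 1) :
    (A * rankOne u.ofLp).trace.re ≤ A.trace.re := by
  obtain ⟨v, rfl⟩ := hA.exists_eq_sum_rankOne
  rw [Matrix.sum_mul, Matrix.trace_sum, Matrix.trace_sum, Complex.re_sum, Complex.re_sum]
  refine Finset.sum_le_sum fun i _ => ?_
  set w : EuclideanSpace ℂ n := WithLp.toLp 2 (v i)
  have h1 : (rankOne (v i)).trace.re = ‖w‖ ^ 2 := by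
    rw [trace_rankOne, ← Complex.ofReal_re (‖w‖ ^ 2), ← sum_mul_star_eq_norm_sq]
  have h2 : (rankOne (v i) * rankOne u.ofLp).trace = ((‖inner ℂ u w‖ ^ 2 : ℝ) : ℂ) := by
    rw [trace_mul_rankOne, rankOne, Matrix.vecMulVec_mulVec, dotProduct_smul]
    have e1 : star u.ofLp ⬝ᵥ v i = inner ℂ u w := dotProduct_star_eq_inner u w
    have e2 : star (v i) ⬝ᵥ u.ofLp = inner ℂ w u := dotProduct_star_eq_inner w u
    rw [e1, e2, ← inner_conj_symm w u]
    rw [op_smul_eq_mul, Complex.mul_conj', Complex.ofReal_pow]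
  rw [h1, h2, Complex.ofReal_re]
  have := norm_inner_le_norm (𝕜 := ℂ) u w
  gcongr
  nlinarith [norm_nonneg w, norm_nonneg u]

theorem exists_trace_mul_eq {n : Type} [Fintype n] (f : Matrix n n ℂ →ₗ[ℂ] ℂ) :
    ∃ W : Matrix n n ℂ, ∀ X, f X = (W * X).trace := by
  classical
  refine ⟨Matrix.of fun p q => f (Matrix.single q p 1), fun X => ?_⟩
  conv_lhs => rw [Matrix.matrix_eq_sum_single X]
  simp only [map_sum, Matrix.trace, Matrix.diag_apply, Matrix.mul_apply, Matrix.of_apply]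
  rw [Finset.sum_comm]
  refine Finset.sum_congr rfl fun i _ => Finset.sum_congr rfl fun j _ => ?_
  rw [← mul_one (X j i), ← smul_eq_mul, ← Matrix.smul_single, map_smul]
  simp [mul_comm]

/-- The witness is `ω i = |⟨T u_i, T ψ⟩| / ‖T ψ‖`. Bessel's inequality for `T† T ψ` bounds its
2-norm, Cauchy–Schwarz bounds each entry by `‖T u_i‖`, and expanding `ψ` in `⟨T ψ, T ψ⟩` gives `‖T
ψ‖ ≤ ⟨ξ, ω⟩`. -/
theorem exists_vector_of_contraction {E F : Type} [NormedAddCommGroup E] [InnerProductSpace ℂ E]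
    [NormedAddCommGroup F] [InnerProductSpace ℂ F] [CompleteSpace E] [CompleteSpace F]
    (T : E →L[ℂ] F) (hT : ∀ x, ‖T x‖ ≤ ‖x‖) {d : ℕ} {u : Fin d → E} (hu : Orthonormal ℂ u)
    {ξ : Fin d → ℝ} (hξ : ∀ i, 0 ≤ ξ i) {c : ℝ} (hc : 0 ≤ c) (huc : ∀ i, ‖T (u i)‖ ^ 2 ≤ c) :
    ∃ ω : Fin d → ℝ, (∀ i, 0 ≤ ω i) ∧ ‖WithLp.toLp 2 ω‖ ≤ 1 ∧ (∀ i, ω i ^ 2 ≤ c) ∧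
      ‖T (∑ i, (ξ i : ℂ) • u i)‖ ^ 2 ≤ (ξ ⬝ᵥ ω) ^ 2 := by
  set ψ := ∑ i, (ξ i : ℂ) • u i with hψ
  by_cases h0 : ‖T ψ‖ = 0
  · exact ⟨0, by simp, by simp, fun _ => by simpa using hc, by simp [h0]⟩
  have hpos : 0 < ‖T ψ‖ := lt_of_le_of_ne (norm_nonneg _) (Ne.symm h0)
  refine ⟨fun i => ‖inner ℂ (T (u i)) (T ψ)‖ / ‖T ψ‖, fun i => by positivity, ?_, fun i => ?_, ?_⟩
  · rw [← sq_le_one_iff₀ (norm_nonneg _), EuclideanSpace.norm_sq_eq]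
    have hadj : ‖ContinuousLinearMap.adjoint T (T ψ)‖ ≤ ‖T ψ‖ := by
      refine (ContinuousLinearMap.le_opNorm _ _).trans ?_
      have : ‖ContinuousLinearMap.adjoint T‖ ≤ 1 := by
        rw [LinearIsometryEquiv.norm_map]
        exact T.opNorm_le_bound zero_le_one (by simpa using hT)
      exact mul_le_of_le_one_left (norm_nonneg _) this
    have hb := hu.sum_inner_products_le (ContinuousLinearMap.adjoint T (T ψ)) (s := Finset.univ)
    simp_rw [ContinuousLinearMap.adjoint_inner_right] at hb
    simp_rw [norm_div, norm_norm, div_pow, ← Finset.sum_div]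
    rw [div_le_one (by positivity)]
    exact hb.trans (by gcongr)
  · rw [div_pow, div_le_iff₀ (by positivity)]
    calc ‖inner ℂ (T (u i)) (T ψ)‖ ^ 2 ≤ (‖T (u i)‖ * ‖T ψ‖) ^ 2 := by
          gcongr
          exact norm_inner_le_norm _ _
      _ = ‖T (u i)‖ ^ 2 * ‖T ψ‖ ^ 2 := mul_pow _ _ _
      _ ≤ c * ‖T ψ‖ ^ 2 := by gcongr; exact huc i
  · have h1 : ‖T ψ‖ ^ 2 ≤ ∑ i, ξ i * ‖inner ℂ (T (u i)) (T ψ)‖ := by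
      have e : inner ℂ (T ψ) (T ψ) = ∑ i, (ξ i : ℂ) * inner ℂ (T (u i)) (T ψ) := by
        conv_lhs => enter [2]; rw [hψ, map_sum]
        rw [sum_inner]
        refine Finset.sum_congr rfl fun i _ => ?_
        rw [map_smul, inner_smul_left, Complex.conj_ofReal]
      have e2 : ‖T ψ‖ ^ 2 = ‖inner ℂ (T ψ) (T ψ)‖ := by
        rw [inner_self_eq_norm_sq_to_K]
        simp
      rw [e2, e]
      refine (norm_sum_le _ _).trans (Finset.sum_le_sum fun i _ => ?_)
      rw [norm_mul, Complex.norm_real, Real.norm_of_nonneg (hξ i)]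
    have h2 : ‖T ψ‖ ≤ ξ ⬝ᵥ fun i => ‖inner ℂ (T (u i)) (T ψ)‖ / ‖T ψ‖ := by
      simp_rw [dotProduct, ← mul_div_assoc, ← Finset.sum_div]
      rw [le_div_iff₀ hpos, ← sq]
      exact h1
    gcongr

theorem inner_toLp_mul {a b : Type} [Fintype a] [Fintype b] (φ φ' : EuclideanSpace ℂ a)
    (η η' : EuclideanSpace ℂ b) :
    inner ℂ (WithLp.toLp 2 fun p : a × b => φ p.1 * η p.2 : EuclideanSpace ℂ (a × b))
      (WithLp.toLp 2 fun p : a × b => φ' p.1 * η' p.2) = inner ℂ φ φ' * inner ℂ η η' := by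
  simp only [PiLp.inner_apply, Fintype.sum_prod_type, Finset.sum_mul_sum]
  refine Finset.sum_congr rfl fun i _ => Finset.sum_congr rfl fun j _ => ?_
  simp only [RCLike.inner_apply, map_mul]
  ring

theorem orthonormal_toLp_mul {a b : Type} [Fintype a] [Fintype b] {ι : Type}
    {e : ι → EuclideanSpace ℂ a} {f : ι → EuclideanSpace ℂ b} (he : Orthonormal ℂ e)
    (hf : Orthonormal ℂ f) :
    Orthonormal ℂ fun i => (WithLp.toLp 2 fun p : a × b => e i p.1 * f i p.2 :
      EuclideanSpace ℂ (a × b)) := by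
  classical
  rw [orthonormal_iff_ite] at he hf ⊢
  intro i j
  rw [inner_toLp_mul, he, hf]
  split_ifs <;> simp

theorem IsSchmidtVector.exists_eq_sum {a b : ℕ} {ψ : EuclideanSpace ℂ (Fin a × Fin b)}
    {ξ : Fin (min a b) → ℝ} (hξ : IsSchmidtVector ψ ξ) :
    ∃ (e : Fin (min a b) → EuclideanSpace ℂ (Fin a))
      (f : Fin (min a b) → EuclideanSpace ℂ (Fin b)), Orthonormal ℂ e ∧ Orthonormal ℂ f ∧
      ψ = ∑ i, (ξ i : ℂ) • (WithLp.toLp 2 fun p : Fin a × Fin b => e i p.1 * f i p.2 :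
        EuclideanSpace ℂ (Fin a × Fin b)) := by
  obtain ⟨-, e, f, he, hf, hψ⟩ := hξ
  refine ⟨e, f, he, hf, ?_⟩
  ext p
  rw [hψ]
  simp

theorem IsSchmidtVector.dotProduct_self {a b : ℕ} {ψ : EuclideanSpace ℂ (Fin a × Fin b)}
    {ξ : Fin (min a b) → ℝ} (hξ : IsSchmidtVector ψ ξ) : ξ ⬝ᵥ ξ = ‖ψ‖ ^ 2 := by
  obtain ⟨e, f, he, hf, hψ⟩ := hξ.exists_eq_sum
  have h := (orthonormal_toLp_mul he hf).inner_sum (fun i => (ξ i : ℂ)) (fun i => (ξ i : ℂ))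
    Finset.univ
  rw [← hψ, inner_self_eq_norm_sq_to_K] at h
  simp only [Complex.conj_ofReal, RCLike.ofReal_eq_complex_ofReal] at h
  rw [dotProduct]
  exact_mod_cast h.symm

theorem norm_maxEntangledVec_le (m : ℕ) : ‖(WithLp.toLp 2 fun p : Fin m × Fin m =>
    if p.1 = p.2 then ((1 / √m : ℝ) : ℂ) else 0 : EuclideanSpace ℂ (Fin m × Fin m))‖ ≤ 1 := by
  rw [← sq_le_one_iff₀ (norm_nonneg _), EuclideanSpace.norm_sq_eq, Fintype.sum_prod_type]
  simp only [apply_ite, norm_zero, ite_pow, Complex.norm_real]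
  simp
  exact mul_inv_le_one

theorem exists_vector_of_mem_ops {O : OpClass} {a b m : ℕ} {ψ : EuclideanSpace ℂ (Fin a × Fin b)}
    {ξ : Fin (min a b) → ℝ} (hξ : IsSchmidtVector ψ ξ)
    {Λ : SuperOp (Fin a × Fin b) (Fin m × Fin m)} (hΛ : Λ ∈ O.ops a b m m) :
    ∃ ω : Fin (min a b) → ℝ, (∀ i, 0 ≤ ω i) ∧ ‖WithLp.toLp 2 ω‖ ≤ 1 ∧ (∀ i, ω i ^ 2 ≤ 1 / m) ∧
      (((Λ (rankOne ψ.ofLp))ᴴ * maxEntangled m).trace).re ≤ (ξ ⬝ᵥ ω) ^ 2 := by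
  have hξ0 := hξ.1
  obtain ⟨e, f, he, hf, hψ⟩ := hξ.exists_eq_sum
  obtain ⟨hcp, hsep⟩ := OpClass.mem_ops hΛ
  -- `W` is the effect `Λ†(Ψ_m)` in the Heisenberg picture.
  obtain ⟨W, hW⟩ := exists_trace_mul_eq
    ((Matrix.traceLinearMap (Fin m × Fin m) ℂ ℂ).comp
      ((LinearMap.mulRight ℂ (maxEntangled m)).comp Λ))
  replace hW : ∀ X, (Λ X * maxEntangled m).trace = (W * X).trace := hW
  have hWpos : W.PosSemidef := by
    refine Matrix.posSemidef_of_dotProduct_mulVec fun x => ?_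
    rw [← trace_mul_rankOne, ← hW]
    exact (hcp.1.posSemidef (posSemidef_rankOne x)).trace_mul_nonneg (posSemidef_rankOne _)
  obtain ⟨B, hB⟩ := hWpos.exists_conjTranspose_mul_self
  let T : EuclideanSpace ℂ (Fin a × Fin b) →L[ℂ] EuclideanSpace ℂ (Fin a × Fin b) :=
    LinearMap.toContinuousLinearMap (Matrix.toEuclideanLin B)
  have hT : ∀ x : EuclideanSpace ℂ (Fin a × Fin b),
      (Λ (rankOne x.ofLp) * maxEntangled m).trace.re = ‖T x‖ ^ 2 := by
    intro x
    rw [hW, trace_mul_rankOne, hB, ← Matrix.mulVec_mulVec, Matrix.dotProduct_mulVec,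
      ← Matrix.star_mulVec]
    have : B *ᵥ x.ofLp = (T x).ofLp := rfl
    rw [this, dotProduct_star_eq_inner, inner_self_eq_norm_sq_to_K]
    norm_cast
  have hT1 : ∀ x, ‖T x‖ ≤ ‖x‖ := by
    intro x
    rw [← sq_le_sq₀ (norm_nonneg _) (norm_nonneg _), ← hT]
    refine ((hcp.1.posSemidef (posSemidef_rankOne x.ofLp)).re_trace_mul_rankOne_le
      (norm_maxEntangledVec_le m)).trans (le_of_eq ?_)
    rw [hcp.2, trace_rankOne, sum_mul_star_eq_norm_sq, Complex.ofReal_re]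
  obtain ⟨ω, h0, h1, h2, h3⟩ := exists_vector_of_contraction T hT1 (orthonormal_toLp_mul he hf) hξ0
    (c := 1 / m) (by positivity) (fun i => by
      rw [← hT]
      exact re_trace_mul_maxEntangled_le (hsep _ (subset_convexHull ℝ _
        ⟨e i, f i, he.1 i, hf.1 i, rfl⟩)))
  refine ⟨ω, h0, h1, h2, ?_⟩
  rw [← hψ, ← hT] at h3
  rwa [(hcp.1.posSemidef (posSemidef_rankOne ψ.ofLp)).1.eq]

/-! ### A one-way protocol -/

/-- Read `w` as the law of a random permutation: `x i` is the probability that `i` is sent into `Fin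
m`. The selected set has at most `m` elements and comes with an injection into `Fin m`. -/
theorem exists_weights_perm {d m : ℕ} (hd : 0 < d) (hm : 0 < m) {x : Fin d → ℝ}
    (hx0 : ∀ i, 0 ≤ x i) (hx1 : ∀ i, x i ≤ 1) (hxm : ∑ i, x i ≤ m) :
    ∃ w : Equiv.Perm (Fin d ⊕ Fin m) → ℝ, (∀ σ, 0 ≤ w σ) ∧ ∑ σ, w σ = 1 ∧
      ∀ i, ∑ σ, w σ * (∑ k, if σ (Sum.inl i) = Sum.inr k then 1 else 0) = x i := by
  have hm' : (0 : ℝ) < m := by exact_mod_cast hm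
  have hd' : (0 : ℝ) < d := by exact_mod_cast hd
  -- The `m` extra entries share the slack equally, so that `y` sums to exactly `m`.
  let y : Fin d ⊕ Fin m → ℝ := Sum.elim x fun _ => (m - ∑ i, x i) / m
  have hs : 0 ≤ ∑ i, x i := Finset.sum_nonneg fun i _ => hx0 i
  have hy0 : ∀ i, 0 ≤ y i := by
    rintro (i | i)
    · exact hx0 i
    · exact div_nonneg (by linarith) hm'.le
  have hy1 : ∀ i, y i ≤ 1 := by
    rintro (i | i)
    · exact hx1 i
    · exact (div_le_one hm').2 (by linarith)
  have hys : ∑ i, y i = m := by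
    rw [Fintype.sum_sum_type]
    simp only [y, Sum.elim_inl, Sum.elim_inr, Finset.sum_const, Finset.card_univ, Fintype.card_fin,
      nsmul_eq_mul]
    field_simp
    ring
  -- Row `i` spreads mass `y i` evenly over the columns `Fin m` and `1 - y i` over `Fin d`; columns
  -- sum to `1` because `y` has total `m`.
  let A : Matrix (Fin d ⊕ Fin m) (Fin d ⊕ Fin m) ℝ := Matrix.of fun i =>
    Sum.elim (fun _ => (1 - y i) / d) fun _ => y i / m
  have hA : A ∈ doublyStochastic ℝ (Fin d ⊕ Fin m) := by
    rw [mem_doublyStochastic_iff_sum]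
    refine ⟨?_, fun i => ?_, ?_⟩
    · rintro i (j | j)
      · exact div_nonneg (by linarith [hy1 i]) hd'.le
      · exact div_nonneg (hy0 i) hm'.le
    · rw [Fintype.sum_sum_type]
      simp only [A, Matrix.of_apply, Sum.elim_inl, Sum.elim_inr, Finset.sum_const, Finset.card_univ,
        Fintype.card_fin, nsmul_eq_mul]
      field_simp
      ring
    · rintro (j | j)
      · simp only [A, Matrix.of_apply, Sum.elim_inl, ← Finset.sum_div, Finset.sum_sub_distrib, hys]
        simp only [Finset.sum_const, Finset.card_univ, Fintype.card_sum, Fintype.card_fin,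
          nsmul_eq_mul]
        push_cast
        field_simp
        ring
      · simp only [A, Matrix.of_apply, Sum.elim_inr, ← Finset.sum_div, hys]
        exact div_self hm'.ne'
  obtain ⟨w, hw0, hw1, hwA⟩ := exists_eq_sum_perm_of_mem_doublyStochastic hA
  refine ⟨w, hw0, hw1, fun i => ?_⟩
  have h1 : ∀ k, ∑ σ, w σ * (if σ (Sum.inl i) = Sum.inr k then 1 else 0) = x i / m := by
    intro k
    have := congrFun (congrFun hwA (Sum.inl i)) (Sum.inr k)
    rw [Matrix.sum_apply] at this
    simp only [Matrix.smul_apply, smul_eq_mul, PEquiv.toMatrix_apply, Equiv.toPEquiv_apply,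
      Option.mem_def, Option.some.injEq, A, Matrix.of_apply, Sum.elim_inr, y, Sum.elim_inl,
      Equiv.Perm.permMatrix] at this
    exact this
  simp_rw [Finset.mul_sum]
  rw [Finset.sum_comm]
  simp_rw [h1]
  simp only [Finset.sum_const, Finset.card_univ, Fintype.card_fin, nsmul_eq_mul]
  field_simp

namespace SuperOp

variable {n : Type} [Fintype n] {m : ℕ}

theorem trace_conj {k : Type} [Fintype k] (K : Matrix k n ℂ) (X : Matrix n n ℂ) :
    (conj K X).trace = (Kᴴ * K * X).trace := by
  rw [conj_apply, Matrix.trace_mul_comm, Matrix.mul_assoc]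

/-- Measure the effect `G` and prepare the first basis state. This completes trace-decreasing maps
to channels. -/
theorem exists_isCP_trace_eq (hm : 0 < m) {G : Matrix n n ℂ} (hG : G.PosSemidef) :
    ∃ R : SuperOp n (Fin m), R.IsCP ∧ ∀ X, (R X).trace = (G * X).trace := by
  classical
  obtain ⟨B, rfl⟩ := hG.exists_conjTranspose_mul_self
  let K : n → Matrix (Fin m) n ℂ := fun i => Matrix.of fun k l => if k = ⟨0, hm⟩ then B i l else 0
  refine ⟨∑ i, conj (K i), IsCP.sum fun i _ => isCP_conj _, fun X => ?_⟩
  have h : Bᴴ * B = ∑ i, (K i)ᴴ * K i := by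
    ext l l'
    rw [Matrix.sum_apply]
    simp [K, Matrix.mul_apply]
  rw [LinearMap.sum_apply, Matrix.trace_sum, h, Matrix.sum_mul, Matrix.trace_sum]
  exact Finset.sum_congr rfl fun i _ => trace_conj _ _

theorem tensor_add_left {a a' b b' : Type} (E E' : SuperOp a a') (D : SuperOp b b') :
    SuperOp.tensor (E + E') D = E.tensor D + E'.tensor D := rfl

theorem tensor_add_right {a a' b b' : Type} (E : SuperOp a a') (D D' : SuperOp b b') :
    SuperOp.tensor E (D + D') = E.tensor D + E.tensor D' := by
  have h : SuperOp.onRight (D + D') a = D.onRight a + D'.onRight a := rfl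
  rw [tensor, tensor, tensor, h, LinearMap.comp_add]

theorem conj_tensor_conj_rankOne {a a' b b' : Type} [Fintype a] [Fintype b] (K : Matrix a' a ℂ)
    (V : Matrix b' b ℂ) {ι : Type} [Fintype ι] (c : ι → ℂ) (e : ι → a → ℂ) (f : ι → b → ℂ) :
    (conj K).tensor (conj V) (rankOne fun p => ∑ i, c i * (e i p.1 * f i p.2)) =
      rankOne fun p => ∑ i, c i * ((K *ᵥ e i) p.1 * (V *ᵥ f i) p.2) := by
  rw [tensor, LinearMap.comp_apply, conj_onRight_rankOne, conj_onLeft_rankOne]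
  congr 1
  ext p
  have h1 : ∀ i, (V *ᵥ fun j => ∑ s, c s * (e s i * f s j)) p.2 =
      ∑ s, c s * (e s i * (V *ᵥ f s) p.2) := by
    intro i
    simp only [Matrix.mulVec, dotProduct, Finset.mul_sum]
    rw [Finset.sum_comm]
    exact Finset.sum_congr rfl fun s _ => Finset.sum_congr rfl fun j _ => by ring
  simp only [h1]
  simp only [Matrix.mulVec, dotProduct, Finset.mul_sum, Finset.sum_mul]
  rw [Finset.sum_comm]
  refine Finset.sum_congr rfl fun s _ => ?_
  rw [Finset.sum_comm]
  exact Finset.sum_congr rfl fun i _ => Finset.sum_congr rfl fun j _ => by ring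

end SuperOp

/-- The matrix with the columns `e i`. -/
def colMatrix {a ι : Type} (e : ι → EuclideanSpace ℂ a) : Matrix a ι ℂ := Matrix.of fun l i => e i l

section colMatrix

variable {a ι : Type} [Fintype a] [DecidableEq ι] {e : ι → EuclideanSpace ℂ a}

theorem colMatrix_conjTranspose_mulVec (he : Orthonormal ℂ e) (i : ι) :
    (colMatrix e)ᴴ *ᵥ (e i).ofLp = Pi.single i 1 := by
  ext j
  have : ((colMatrix e)ᴴ *ᵥ (e i).ofLp) j = star (e j).ofLp ⬝ᵥ (e i).ofLp := rfl
  rw [this, dotProduct_star_eq_inner, orthonormal_iff_ite.1 he, Pi.single_apply]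

theorem colMatrix_conjTranspose_mul_self (he : Orthonormal ℂ e) :
    (colMatrix e)ᴴ * colMatrix e = 1 := by
  ext j i
  have : ((colMatrix e)ᴴ * colMatrix e) j i = ((colMatrix e)ᴴ *ᵥ (e i).ofLp) j := rfl
  rw [this, colMatrix_conjTranspose_mulVec he, Matrix.one_apply, Pi.single_apply]

/-- The matrix splits as the projection `1 - U Uᴴ` plus `U (1 - t) Uᴴ`. -/
theorem posSemidef_one_sub_colMatrix [Fintype ι] [DecidableEq a] (he : Orthonormal ℂ e) {t : ι → ℝ}
    (ht : ∀ i, t i ≤ 1) :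
    (1 - colMatrix e * Matrix.diagonal (fun i => (t i : ℂ)) * (colMatrix e)ᴴ).PosSemidef := by
  set U := colMatrix e
  have hU : Uᴴ * U = 1 := colMatrix_conjTranspose_mul_self he
  have h1 : (1 - U * Uᴴ).PosSemidef := by
    have h : (1 - U * Uᴴ)ᴴ * (1 - U * Uᴴ) = 1 - U * Uᴴ := by
      have hUU : U * Uᴴ * (U * Uᴴ) = U * Uᴴ := by
        rw [Matrix.mul_assoc, ← Matrix.mul_assoc Uᴴ, hU, Matrix.one_mul]
      rw [Matrix.conjTranspose_sub, Matrix.conjTranspose_one, Matrix.conjTranspose_mul,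
        Matrix.conjTranspose_conjTranspose, Matrix.sub_mul, Matrix.mul_sub, Matrix.mul_sub, hUU,
        Matrix.one_mul, Matrix.mul_one, Matrix.one_mul, sub_self, sub_zero]
    rw [← h]
    exact Matrix.posSemidef_conjTranspose_mul_self _
  have h2 : (U * Matrix.diagonal (fun i => ((1 - t i : ℝ) : ℂ)) * Uᴴ).PosSemidef :=
    (Matrix.PosSemidef.diagonal fun i => by
      simpa [← Complex.ofReal_one] using ht i).mul_mul_conjTranspose_same U
  convert h1.add h2 using 1
  have h3 : Matrix.diagonal (fun i => ((1 - t i : ℝ) : ℂ)) =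
      1 - Matrix.diagonal (fun i => (t i : ℂ)) := by
    rw [← Matrix.diagonal_one, Matrix.diagonal_sub]
    congr 1
    ext i
    push_cast
    rfl
  rw [h3, Matrix.mul_sub, Matrix.sub_mul, Matrix.mul_one]
  abel

end colMatrix

/-- The partial permutation matrix of the part of `σ` that maps `Fin d` to `Fin m`. -/
def partialPerm {d m : ℕ} (σ : Equiv.Perm (Fin d ⊕ Fin m)) : Matrix (Fin m) (Fin d) ℂ :=
  Matrix.of fun k i => if σ (Sum.inl i) = Sum.inr k then 1 else 0

/-- The indicator of `σ` mapping `i : Fin d` to `Fin m`. -/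
def partialPermInd {d m : ℕ} (σ : Equiv.Perm (Fin d ⊕ Fin m)) (i : Fin d) : ℝ :=
  ∑ k : Fin m, if σ (Sum.inl i) = Sum.inr k then 1 else 0

theorem partialPermInd_eq {d m : ℕ} (σ : Equiv.Perm (Fin d ⊕ Fin m)) (i : Fin d) :
    partialPermInd σ i = if ∃ k, σ (Sum.inl i) = Sum.inr k then 1 else 0 := by
  rw [partialPermInd]
  split_ifs with h
  · obtain ⟨k, hk⟩ := h
    simp [hk]
  · push Not at h
    simp [h]

theorem partialPerm_conjTranspose_mul_self {d m : ℕ} (σ : Equiv.Perm (Fin d ⊕ Fin m)) :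
    (partialPerm σ)ᴴ * partialPerm σ = Matrix.diagonal fun i => (partialPermInd σ i : ℂ) := by
  ext i j
  rw [Matrix.mul_apply, Matrix.diagonal_apply]
  simp only [partialPerm, Matrix.conjTranspose_apply, Matrix.of_apply]
  split_ifs with h
  · subst h
    rw [partialPermInd]
    push_cast
    refine Finset.sum_congr rfl fun k _ => ?_
    split_ifs <;> simp
  · refine Finset.sum_eq_zero fun k _ => ?_
    split_ifs with h1 h2
    · exact absurd (Sum.inl_injective (σ.injective (h1.trans h2.symm))) h
    all_goals simp

theorem exists_oneWayLOCC {a b m : ℕ} (hm : 0 < m) (hd : 0 < min a b)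
    {ψ : EuclideanSpace ℂ (Fin a × Fin b)} {ξ ω : Fin (min a b) → ℝ} (hξ : IsSchmidtVector ψ ξ)
    (hω1 : ‖WithLp.toLp 2 ω‖ ≤ 1) (hωm : ∀ i, ω i ^ 2 ≤ 1 / m) :
    ∃ Λ : SuperOp (Fin a × Fin b) (Fin m × Fin m), IsOneWayLOCC Λ ∧
      (ξ ⬝ᵥ ω) ^ 2 ≤ (((Λ (rankOne ψ.ofLp))ᴴ * maxEntangled m).trace).re := by
  classical
  obtain ⟨-, e, f, he, hf, hψ⟩ := hξ
  have hm' : (0 : ℝ) < m := by exact_mod_cast hm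
  obtain ⟨w, hw0, hw1, hwx⟩ := exists_weights_perm hd hm (x := fun i => m * ω i ^ 2)
    (fun i => by positivity)
    (fun i => by have := hωm i; rw [le_div_iff₀ hm'] at this; linarith) (by
      rw [← Finset.mul_sum]
      refine mul_le_of_le_one_right hm'.le ?_
      rw [← sq_le_one_iff₀ (norm_nonneg _), EuclideanSpace.norm_sq_eq] at hω1
      simpa using hω1)
  -- The weight of `i` in Alice's total effect is `(m ω i ^ 2) / (m ω i ^ 2)`: it is `1` if `ω i ≠
  -- 0`, and `0` otherwise by the convention for division by zero.
  set c : Equiv.Perm (Fin (min a b) ⊕ Fin m) → Fin (min a b) → ℝ :=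
    fun σ i => √(w σ) / (√m * ω i) with hc
  let K : Equiv.Perm (Fin (min a b) ⊕ Fin m) → Matrix (Fin m) (Fin a) ℂ := fun σ =>
    partialPerm σ * Matrix.diagonal (fun i => (c σ i : ℂ)) * (colMatrix e)ᴴ
  let V : Equiv.Perm (Fin (min a b) ⊕ Fin m) → Matrix (Fin m) (Fin b) ℂ := fun σ =>
    partialPerm σ * (colMatrix f)ᴴ
  -- the operators of Alice
  let t : Fin (min a b) → ℝ := fun i => ∑ σ, c σ i ^ 2 * partialPermInd σ i
  have ht : ∀ i, t i ≤ 1 := by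
    intro i
    have h1 : t i = (m * ω i ^ 2) / (m * ω i ^ 2) := by
      simp only [t]
      conv_rhs => enter [1]; rw [← hwx i]
      rw [Finset.sum_div]
      refine Finset.sum_congr rfl fun σ _ => ?_
      simp only [c]
      rw [div_pow, Real.sq_sqrt (hw0 σ), mul_pow, Real.sq_sqrt hm'.le, partialPermInd]
      ring
    rw [h1]
    exact div_self_le_one _
  have hKK : ∑ σ, (K σ)ᴴ * K σ =
      colMatrix e * Matrix.diagonal (fun i => (t i : ℂ)) * (colMatrix e)ᴴ := by
    have h1 : ∀ σ, (K σ)ᴴ * K σ = colMatrix e *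
        Matrix.diagonal (fun i => ((c σ i ^ 2 * partialPermInd σ i : ℝ) : ℂ)) *
        (colMatrix e)ᴴ := by
      intro σ
      simp only [K, Matrix.conjTranspose_mul, Matrix.conjTranspose_conjTranspose,
        Matrix.diagonal_conjTranspose, Matrix.mul_assoc]
      rw [← Matrix.mul_assoc (partialPerm σ)ᴴ, partialPerm_conjTranspose_mul_self,
        ← Matrix.mul_assoc (Matrix.diagonal _) (Matrix.diagonal _), Matrix.diagonal_mul_diagonal,
        ← Matrix.mul_assoc (Matrix.diagonal _) (Matrix.diagonal _), Matrix.diagonal_mul_diagonal]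
      congr 3
      ext i
      simp only [Pi.star_apply, Complex.star_def, Complex.conj_ofReal]
      push_cast
      ring
    simp_rw [h1]
    rw [← Matrix.sum_mul, ← Matrix.mul_sum]
    congr 2
    ext i j
    rw [Matrix.sum_apply]
    simp only [Matrix.diagonal_apply, t]
    split_ifs <;> simp
  obtain ⟨R, hR, hRtr⟩ := SuperOp.exists_isCP_trace_eq hm (posSemidef_one_sub_colMatrix he ht)
  -- the channels of Bob
  have hVV : ∀ σ, (V σ)ᴴ * V σ =
      colMatrix f * Matrix.diagonal (fun i => (partialPermInd σ i : ℂ)) * (colMatrix f)ᴴ := by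
    intro σ
    simp only [V, Matrix.conjTranspose_mul, Matrix.conjTranspose_conjTranspose, Matrix.mul_assoc]
    rw [← Matrix.mul_assoc (partialPerm σ)ᴴ, partialPerm_conjTranspose_mul_self]
  have hind : ∀ σ i, partialPermInd (d := min a b) (m := m) σ i ≤ 1 := by
    intro σ i
    rw [partialPermInd_eq]
    split_ifs <;> simp
  choose S hS hStr using fun σ =>
    SuperOp.exists_isCP_trace_eq hm (posSemidef_one_sub_colMatrix hf (hind σ))
  -- Alice's missing effect is distributed over the outcomes with the weights `w σ`, which sum to
  -- `1`.
  let E : Equiv.Perm (Fin (min a b) ⊕ Fin m) → SuperOp (Fin a) (Fin m) := fun σ =>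
    SuperOp.conj (K σ) + (w σ : ℂ) • R
  let D : Equiv.Perm (Fin (min a b) ⊕ Fin m) → SuperOp (Fin b) (Fin m) := fun σ =>
    SuperOp.conj (V σ) + S σ
  have hE : ∀ σ, (E σ).IsCP := fun σ => (SuperOp.isCP_conj _).add (hR.smul (hw0 σ))
  have hEtr : ∀ X, ∑ σ, (E σ X).trace = X.trace := by
    intro X
    have h1 : ∀ σ, (E σ X).trace = ((K σ)ᴴ * K σ * X).trace + (w σ : ℂ) * (R X).trace := by
      intro σ
      rw [← SuperOp.trace_conj, ← smul_eq_mul, ← Matrix.trace_smul, ← Matrix.trace_add]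
      rfl
    simp_rw [h1, Finset.sum_add_distrib, ← Finset.sum_mul]
    rw [← Matrix.trace_sum, ← Matrix.sum_mul, hKK, ← Complex.ofReal_sum, hw1, Complex.ofReal_one,
      one_mul, hRtr, ← Matrix.trace_add, ← Matrix.add_mul, add_sub_cancel, Matrix.one_mul]
  have hD : ∀ σ, (D σ).IsCPTP := by
    refine fun σ => ⟨(SuperOp.isCP_conj _).add (hS σ), fun X => ?_⟩
    have h1 : (D σ X).trace = ((V σ)ᴴ * V σ * X).trace + (S σ X).trace := by
      rw [← SuperOp.trace_conj, ← Matrix.trace_add]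
      rfl
    rw [h1, hStr, hVV, ← Matrix.trace_add, ← Matrix.add_mul, add_sub_cancel, Matrix.one_mul]
  -- the protocol
  let q := (Fintype.equivFin (Equiv.Perm (Fin (min a b) ⊕ Fin m))).symm
  have hsum : ∑ j, (E (q j)).tensor (D (q j)) = ∑ σ, (E σ).tensor (D σ) :=
    Equiv.sum_comp q fun σ => (E σ).tensor (D σ)
  refine ⟨∑ σ, (E σ).tensor (D σ), ⟨_, fun j => E (q j), fun j => D (q j),
    ⟨fun j => hE _, fun X => ?_⟩, fun j => hD _, hsum.symm⟩, ?_⟩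
  · rw [← hEtr X]
    exact Equiv.sum_comp q fun σ => (E σ X).trace
  set ρ := rankOne ψ.ofLp with hρ
  have hρpos : ρ.PosSemidef := posSemidef_rankOne _
  have hΨ : (maxEntangled m).PosSemidef := posSemidef_rankOne _
  have hpos : ∀ σ, ((E σ).tensor (D σ) ρ).PosSemidef :=
    fun σ => ((hE σ).tensor (hD σ).1).posSemidef hρpos
  rw [LinearMap.sum_apply, (Matrix.posSemidef_sum _ fun σ _ => hpos σ).1.eq, Matrix.sum_mul,
    Matrix.trace_sum, Complex.re_sum]
  -- The completing terms are positive, so dropping them only lowers the overlap.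
  have hlow : ∀ σ, ((SuperOp.conj (K σ)).tensor (SuperOp.conj (V σ)) ρ * maxEntangled m).trace.re ≤
      ((E σ).tensor (D σ) ρ * maxEntangled m).trace.re := by
    intro σ
    have h1 : (E σ).tensor (D σ) ρ = (SuperOp.conj (K σ)).tensor (SuperOp.conj (V σ)) ρ +
        ((SuperOp.conj (K σ)).tensor (S σ) ρ + SuperOp.tensor ((w σ : ℂ) • R) (D σ) ρ) := by
      simp only [E]
      rw [SuperOp.tensor_add_left, LinearMap.add_apply]
      conv_lhs => enter [1]; simp only [D]; rw [SuperOp.tensor_add_right, LinearMap.add_apply]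
      rw [add_assoc]
    have h2 : ((SuperOp.conj (K σ)).tensor (S σ) ρ +
        SuperOp.tensor ((w σ : ℂ) • R) (D σ) ρ).PosSemidef :=
      (((SuperOp.isCP_conj _).tensor (hS σ)).posSemidef hρpos).add
        (((hR.smul (hw0 σ)).tensor (hD σ).1).posSemidef hρpos)
    rw [h1, Matrix.add_mul, Matrix.trace_add, Complex.add_re]
    have := (Complex.le_def.1 (h2.trace_mul_nonneg hΨ)).1
    simpa using this
  refine le_trans ?_ (Finset.sum_le_sum fun σ _ => hlow σ)
  -- Both parties send a selected index `i` to the same basis vector `k`, so the selected Schmidt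
  -- terms add coherently against `Ψ_m`.
  have hval : ∀ σ, ((SuperOp.conj (K σ)).tensor (SuperOp.conj (V σ)) ρ * maxEntangled m).trace.re =
      1 / m * (∑ i, ξ i * c σ i * partialPermInd σ i) ^ 2 := by
    intro σ
    have hKe : ∀ i k, (K σ *ᵥ (e i).ofLp) k = partialPerm σ k i * c σ i := by
      intro i k
      simp only [K]
      rw [← Matrix.mulVec_mulVec, colMatrix_conjTranspose_mulVec he, Matrix.mulVec_single_one,
        Matrix.col_apply, Matrix.mul_diagonal]
    have hVf : ∀ i k, (V σ *ᵥ (f i).ofLp) k = partialPerm σ k i := by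
      intro i k
      simp only [V]
      rw [← Matrix.mulVec_mulVec, colMatrix_conjTranspose_mulVec hf, Matrix.mulVec_single_one,
        Matrix.col_apply]
    have h1 : ρ = rankOne fun p => ∑ i, (ξ i : ℂ) * (e i p.1 * f i p.2) := by
      rw [hρ]
      congr 1
      ext p
      exact hψ p
    rw [h1, SuperOp.conj_tensor_conj_rankOne, trace_mul_maxEntangled]
    simp only [hKe, hVf]
    set z : Fin m × Fin m → ℂ := fun p =>
      ∑ i, (ξ i : ℂ) * (partialPerm σ p.1 i * c σ i * partialPerm σ p.2 i) with hz
    have h2 : ∑ k, z (k, k) = ((∑ i, ξ i * c σ i * partialPermInd σ i : ℝ) : ℂ) := by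
      simp only [hz]
      rw [Finset.sum_comm]
      push_cast
      refine Finset.sum_congr rfl fun i _ => ?_
      rw [partialPermInd]
      push_cast
      rw [Finset.mul_sum]
      refine Finset.sum_congr rfl fun k _ => ?_
      simp only [partialPerm, Matrix.of_apply]
      split_ifs <;> simp
    have h3 : ∑ i, ∑ j, partialTranspose (Fin m) (Fin m) (rankOne z) (i, j) (j, i) =
        (∑ k, z (k, k)) * star (∑ k, z (k, k)) := by
      rw [star_sum, Finset.sum_mul_sum]
      rfl
    rw [h3, h2, Complex.star_def, Complex.conj_ofReal, ← Complex.ofReal_mul, ← Complex.ofReal_mul,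
      Complex.ofReal_re, sq]
  simp_rw [hval]
  rw [← Finset.mul_sum]
  set y : Equiv.Perm (Fin (min a b) ⊕ Fin m) → ℝ := fun σ =>
    ∑ i, ξ i * (√m * ω i)⁻¹ * partialPermInd σ i with hy
  have hcy : ∀ σ, ∑ i, ξ i * c σ i * partialPermInd σ i = √(w σ) * y σ := by
    intro σ
    simp only [hy, hc, Finset.mul_sum]
    exact Finset.sum_congr rfl fun i _ => by ring
  have hwy : ∑ σ, w σ * y σ = √m * (ξ ⬝ᵥ ω) := by
    simp only [hy, Finset.mul_sum, dotProduct]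
    rw [Finset.sum_comm]
    refine Finset.sum_congr rfl fun i _ => ?_
    have h1 : ∑ σ, w σ * (ξ i * (√m * ω i)⁻¹ * partialPermInd σ i) =
        ξ i * (√m * ω i)⁻¹ * (m * ω i ^ 2) := by
      rw [← hwx i, Finset.mul_sum]
      refine Finset.sum_congr rfl fun σ _ => ?_
      rw [partialPermInd]
      ring
    rw [h1]
    by_cases h0 : ω i = 0
    · simp [h0]
    · have : (m : ℝ) = √m * √m := (Real.mul_self_sqrt hm'.le).symm
      have h2 : √(m : ℝ) ≠ 0 := (Real.sqrt_pos.2 hm').ne'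
      nth_rw 2 [this]
      field_simp
  -- Cauchy–Schwarz for the probability weights `w`: the squared mean of `y` is at most the mean of
  -- `y ^ 2`.
  have hcs := Finset.sum_sq_le_sum_mul_sum_of_sq_le_mul Finset.univ (r := fun σ => w σ * y σ)
    (f := w) (g := fun σ => (√(w σ) * y σ) ^ 2) (fun σ _ => hw0 σ) (fun σ _ => sq_nonneg _)
    (fun σ _ => le_of_eq (by rw [mul_pow, mul_pow, Real.sq_sqrt (hw0 σ)]; ring))
  rw [hwy, hw1, one_mul, mul_pow, Real.sq_sqrt hm'.le] at hcs
  simp_rw [hcy]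
  rw [one_div, inv_mul_eq_div, le_div_iff₀ hm']
  linarith

/-! ### The Schmidt decomposition -/

/-- Singular value decomposition: for an eigenbasis `e` of `M Mᴴ`, the rows `(e k)ᴴ M` are pairwise
orthogonal with squared norms the eigenvalues. -/
theorem exists_schmidt_of_le {a b : ℕ} (hab : a ≤ b) (M : Matrix (Fin a) (Fin b) ℂ) :
    ∃ (s : Fin a → ℝ) (e : Fin a → EuclideanSpace ℂ (Fin a))
      (f : Fin a → EuclideanSpace ℂ (Fin b)), (∀ k, 0 ≤ s k) ∧ Orthonormal ℂ e ∧
      Orthonormal ℂ f ∧ ∀ i j, M i j = ∑ k, (s k : ℂ) * (e k i * f k j) := by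
  have hpos : (M * Mᴴ).PosSemidef := Matrix.posSemidef_self_mul_conjTranspose M
  have hH := hpos.1
  let e := hH.eigenvectorBasis
  let U : Matrix (Fin a) (Fin a) ℂ := hH.eigenvectorUnitary
  have hU : U * Uᴴ = 1 := Unitary.coe_mul_star_self hH.eigenvectorUnitary
  let g : Fin a → EuclideanSpace ℂ (Fin b) := fun k => WithLp.toLp 2 (star (e k).ofLp ᵥ* M)
  have hg : ∀ k l, inner ℂ (g k) (g l) = if k = l then (hH.eigenvalues k : ℂ) else 0 := by
    intro k l
    have h1 : star (g k).ofLp = Mᴴ *ᵥ (e k).ofLp := by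
      change star (star (e k).ofLp ᵥ* M) = _
      rw [Matrix.star_vecMul, star_star]
    rw [← dotProduct_star_eq_inner, dotProduct_comm, h1]
    change (star (e l).ofLp ᵥ* M) ⬝ᵥ (Mᴴ *ᵥ (e k).ofLp) = _
    rw [← Matrix.dotProduct_mulVec, Matrix.mulVec_mulVec, hH.mulVec_eigenvectorBasis,
      dotProduct_smul, dotProduct_star_eq_inner, orthonormal_iff_ite.1 e.orthonormal]
    by_cases h : k = l
    · simp [h]
    · simp [h, Ne.symm h]
  have hM : ∀ i j, M i j = ∑ k, e k i * g k j := by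
    intro i j
    have h1 : M = U * (Uᴴ * M) := by rw [← Matrix.mul_assoc, hU, Matrix.one_mul]
    conv_lhs => rw [h1]
    rfl
  let s : Fin a → ℝ := fun k => √(hH.eigenvalues k)
  have hs2 : ∀ k, s k * s k = hH.eigenvalues k := fun k =>
    Real.mul_self_sqrt (hpos.eigenvalues_nonneg k)
  -- Only the normalised rows with nonzero singular value, indexed by `S`, are prescribed; the
  -- extension to an orthonormal basis supplies the others.
  let v : Fin b → EuclideanSpace ℂ (Fin b) := fun j =>
    if h : (j : ℕ) < a then (((s ⟨j, h⟩)⁻¹ : ℝ) : ℂ) • g ⟨j, h⟩ else 0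
  let S : Set (Fin b) := {j | ∃ h : (j : ℕ) < a, s ⟨j, h⟩ ≠ 0}
  have hv : Orthonormal ℂ (S.domRestrict v) := by
    rw [orthonormal_iff_ite]
    rintro ⟨i, hi, hsi⟩ ⟨j, hj, hsj⟩
    simp only [Set.domRestrict_apply, v, dif_pos hi, dif_pos hj, inner_smul_left, inner_smul_right,
      hg, Complex.conj_ofReal]
    by_cases h : i = j
    · subst h
      have : (s ⟨i, hi⟩ : ℂ) ≠ 0 := by exact_mod_cast hsi
      simp only [if_true, ← hs2]
      push_cast
      field_simp
    · have h' : (⟨i, hi⟩ : Fin a) ≠ ⟨j, hj⟩ := fun h1 => h (Fin.ext (Fin.mk.inj h1))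
      simp [h, h']
  obtain ⟨B, hB⟩ := hv.exists_orthonormalBasis_extension_of_card_eq (by simp)
  refine ⟨s, e, fun k => B (Fin.castLE hab k), fun k => Real.sqrt_nonneg _, e.orthonormal,
    B.orthonormal.comp _ (Fin.castLE_injective hab), fun i j => ?_⟩
  rw [hM]
  refine Finset.sum_congr rfl fun k _ => ?_
  have hk : g k = (s k : ℂ) • B (Fin.castLE hab k) := by
    by_cases h0 : s k = 0
    · have h1 := hg k k
      rw [if_pos rfl, ← hs2, h0] at h1
      simp only [mul_zero, Complex.ofReal_zero, inner_self_eq_zero] at h1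
      simp [h1, h0]
    · rw [hB _ ⟨k.2, h0⟩]
      simp only [v, Fin.val_castLE, Fin.is_lt, dif_pos, Fin.eta, smul_smul]
      rw [← Complex.ofReal_mul, mul_inv_cancel₀ h0, Complex.ofReal_one, one_smul]
  rw [hk]
  simp only [PiLp.smul_apply, smul_eq_mul]
  ring

theorem exists_isSchmidtVector {a b : ℕ} (ψ : EuclideanSpace ℂ (Fin a × Fin b)) :
    ∃ ξ : Fin (min a b) → ℝ, IsSchmidtVector ψ ξ := by
  rcases le_total a b with hab | hab
  · obtain ⟨s, e, f, hs, he, hf, h⟩ := exists_schmidt_of_le hab (Matrix.of fun i j => ψ (i, j))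
    let c := finCongr (min_eq_left hab)
    refine ⟨s ∘ c, fun i => hs _, e ∘ c, f ∘ c, he.comp _ c.injective, hf.comp _ c.injective,
      fun p => (h p.1 p.2).trans ?_⟩
    exact (Equiv.sum_comp c fun k => (s k : ℂ) * (e k p.1 * f k p.2)).symm
  · obtain ⟨s, e, f, hs, he, hf, h⟩ := exists_schmidt_of_le hab (Matrix.of fun i j => ψ (j, i))
    let c := finCongr (min_eq_right hab)
    refine ⟨s ∘ c, fun i => hs _, f ∘ c, e ∘ c, hf.comp _ c.injective, he.comp _ c.injective,
      fun p => (h p.2 p.1).trans ?_⟩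
    rw [← Equiv.sum_comp c]
    exact Finset.sum_congr rfl fun k _ => by simp only [Function.comp_apply]; ring

/-! ### The optimisation problem -/

/-- Positivity of `d` matters: for `d = 0` the right side is vacuous even when `s < 0`. -/
theorem norm_sq_le_iff {d : ℕ} (hd : 0 < d) (ω : Fin d → ℝ) (s : ℝ) :
    ‖ω‖ ^ 2 ≤ s ↔ ∀ i, ω i ^ 2 ≤ s := by
  constructor
  · intro h i
    refine le_trans ?_ h
    rw [← sq_abs]
    have := norm_le_pi_norm ω i
    rw [Real.norm_eq_abs] at this
    gcongr
  · intro h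
    have hs : 0 ≤ s := (sq_nonneg _).trans (h ⟨0, hd⟩)
    rw [← Real.le_sqrt (norm_nonneg _) hs, pi_norm_le_iff_of_nonneg (Real.sqrt_nonneg _)]
    exact fun i => Real.abs_le_sqrt (h i)

theorem continuous_norm_toLp {d : ℕ} :
    Continuous fun ω : Fin d → ℝ => ‖(WithLp.toLp 2 ω : EuclideanSpace ℝ (Fin d))‖ :=
  (PiLp.continuous_toLp 2 _).norm

theorem norm_toLp_sq {d : ℕ} (ω : Fin d → ℝ) :
    ‖(WithLp.toLp 2 ω : EuclideanSpace ℝ (Fin d))‖ ^ 2 = ∑ i, ω i ^ 2 := by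
  rw [EuclideanSpace.norm_sq_eq]
  simp

theorem norm_toLp_le_one_iff {d : ℕ} (ω : Fin d → ℝ) :
    ‖(WithLp.toLp 2 ω : EuclideanSpace ℝ (Fin d))‖ ≤ 1 ↔ ∑ i, ω i ^ 2 ≤ 1 := by
  rw [← sq_le_one_iff₀ (norm_nonneg _), norm_toLp_sq]

theorem isCompact_unitBall_toLp {d : ℕ} :
    IsCompact {ω : Fin d → ℝ | ‖(WithLp.toLp 2 ω : EuclideanSpace ℝ (Fin d))‖ ≤ 1} := by
  refine Metric.isCompact_of_isClosed_isBounded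
    (isClosed_le continuous_norm_toLp continuous_const)
    ((Metric.isBounded_closedBall (x := 0) (r := 1)).subset fun ω hω => ?_)
  rw [mem_closedBall_zero_iff, pi_norm_le_iff_of_nonneg zero_le_one]
  exact fun i => (PiLp.norm_apply_le (WithLp.toLp 2 ω : EuclideanSpace ℝ (Fin d)) i).trans hω

theorem continuous_dotProduct_left {d : ℕ} (ξ : Fin d → ℝ) :
    Continuous fun ω : Fin d → ℝ => ξ ⬝ᵥ ω := by
  unfold dotProduct
  fun_prop

theorem isCompact_feasibleVectors {d : ℕ} (ξ : Fin d → ℝ) (ε : ℝ) :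
    IsCompact (feasibleVectors ξ ε) := by
  have h : feasibleVectors ξ ε =
      {ω : Fin d → ℝ | ‖(WithLp.toLp 2 ω : EuclideanSpace ℝ (Fin d))‖ ≤ 1} ∩
      ({ω | √(1 - ε) ≤ ξ ⬝ᵥ ω} ∩ {ω | ∀ i, 0 ≤ ω i}) := by
    ext ω
    simp only [feasibleVectors, Set.mem_ofPred_eq, Set.mem_inter_iff]
    tauto
  rw [h]
  refine isCompact_unitBall_toLp.inter_right
    ((isClosed_le continuous_const (continuous_dotProduct_left ξ)).inter ?_)
  rw [Set.ofPred_forall]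
  exact isClosed_iInter fun i => isClosed_le continuous_const (continuous_apply i)

/-- The fidelity is a supremum over maps, with attainment not assumed. A maximiser `ω` bounds all of
them at once, so a bound on the supremum yields one feasible vector. -/
theorem exists_isMaxOn_dotProduct {d : ℕ} (ξ : Fin d → ℝ) {c : ℝ} (hc : 0 ≤ c) :
    ∃ ω : Fin d → ℝ, ((∀ i, 0 ≤ ω i) ∧ ‖WithLp.toLp 2 ω‖ ≤ 1 ∧ ∀ i, ω i ^ 2 ≤ c) ∧
      ∀ ω' : Fin d → ℝ, (∀ i, 0 ≤ ω' i) → ‖WithLp.toLp 2 ω'‖ ≤ 1 → (∀ i, ω' i ^ 2 ≤ c) →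
        ξ ⬝ᵥ ω' ≤ ξ ⬝ᵥ ω := by
  have hK : IsCompact ({ω : Fin d → ℝ | ‖(WithLp.toLp 2 ω : EuclideanSpace ℝ (Fin d))‖ ≤ 1} ∩
      ({ω | ∀ i, 0 ≤ ω i} ∩ {ω | ∀ i, ω i ^ 2 ≤ c})) := by
    refine isCompact_unitBall_toLp.inter_right (IsClosed.inter ?_ ?_)
    · rw [Set.ofPred_forall]
      exact isClosed_iInter fun i => isClosed_le continuous_const (continuous_apply i)
    · rw [Set.ofPred_forall]
      exact isClosed_iInter fun i => isClosed_le ((continuous_apply i).pow 2) continuous_const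
  obtain ⟨ω, ⟨h1, h2, h3⟩, hmax⟩ := hK.exists_isMaxOn
    ⟨0, by simp, by simp, by simpa using fun _ => hc⟩ (continuous_dotProduct_left ξ).continuousOn
  exact ⟨ω, ⟨h2, h1, h3⟩, fun ω' h0 h1 h2 => hmax ⟨h1, h0, h2⟩⟩

theorem isConvex_pureStateQCLP {d : ℕ} (ξ : Fin d → ℝ) (ε : ℝ) :
    (pureStateQCLP ξ ε).IsConvex := by
  rintro (i | i | (_ | _))
  · refine Matrix.PosSemidef.diagonal fun j => ?_
    by_cases h : j = Sum.inl i
    · subst h; simp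
    · simp [Pi.single_eq_of_ne h]
  · exact Matrix.PosSemidef.zero
  · exact Matrix.PosSemidef.zero
  · refine Matrix.PosSemidef.diagonal fun j => ?_
    cases j <;> simp

theorem mem_feasible_pureStateQCLP_iff {d : ℕ} (hd : 0 < d) (ξ : Fin d → ℝ) (ε : ℝ)
    (ω : Fin d → ℝ) (s : ℝ) :
    Sum.elim ω (fun _ => s) ∈ (pureStateQCLP ξ ε).feasible ↔
      ω ∈ feasibleVectors ξ ε ∧ ‖ω‖ ^ 2 ≤ s := by
  rw [norm_sq_le_iff hd]
  set x : Fin d ⊕ Unit → ℝ := Sum.elim ω fun _ => s with hx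
  set Q := pureStateQCLP ξ ε with hQ
  have h1 : ∀ i, x ⬝ᵥ (Q.P (.inl i) *ᵥ x) + Q.q (.inl i) ⬝ᵥ x + Q.r (.inl i) = ω i ^ 2 - s := by
    intro i
    have : Q.P (.inl i) *ᵥ x = Pi.single (Sum.inl i) (ω i) := by
      ext j
      simp only [hQ, pureStateQCLP, Matrix.mulVec_diagonal]
      by_cases h : j = Sum.inl i
      · subst h; simp [hx]
      · simp [Pi.single_eq_of_ne h]
    rw [this, dotProduct_single]
    simp only [hQ, pureStateQCLP, single_dotProduct, hx, Sum.elim_inl, Sum.elim_inr]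
    ring
  have h2 : ∀ i, x ⬝ᵥ (Q.P (.inr (.inl i)) *ᵥ x) + Q.q (.inr (.inl i)) ⬝ᵥ x +
      Q.r (.inr (.inl i)) = - ω i := by
    intro i
    simp [hQ, pureStateQCLP, hx]
  have h3 : x ⬝ᵥ (Q.P (.inr (.inr true)) *ᵥ x) + Q.q (.inr (.inr true)) ⬝ᵥ x +
      Q.r (.inr (.inr true)) = ∑ i, ω i ^ 2 - 1 := by
    simp [hQ, pureStateQCLP, hx, dotProduct, Matrix.mulVec_diagonal, sq, sub_eq_add_neg]
  have h4 : x ⬝ᵥ (Q.P (.inr (.inr false)) *ᵥ x) + Q.q (.inr (.inr false)) ⬝ᵥ x +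
      Q.r (.inr (.inr false)) = √(1 - ε) - ξ ⬝ᵥ ω := by
    simp [hQ, pureStateQCLP, hx, dotProduct]
    ring
  simp only [QCLP.feasible, Set.mem_ofPred_eq, Sum.forall, Bool.forall_bool, h1, h2, h3, h4,
    feasibleVectors, norm_toLp_le_one_iff, sub_nonpos, neg_nonpos]
  tauto

theorem dotProduct_c_pureStateQCLP {d : ℕ} (ξ : Fin d → ℝ) (ε : ℝ) (x : Fin d ⊕ Unit → ℝ) :
    (pureStateQCLP ξ ε).c ⬝ᵥ x = x (Sum.inr ()) := by
  simp [pureStateQCLP]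

/-! ### The main theorem -/

theorem distillableSizes_eq {a b : ℕ} {ψ : EuclideanSpace ℂ (Fin a × Fin b)}
    (hd : 0 < min a b) {ε : ℝ} {ξ : Fin (min a b) → ℝ}
    (hξ : IsSchmidtVector ψ ξ) {μ : ℝ}
    (hμ : IsLeast ((fun ω : Fin (min a b) → ℝ => ‖ω‖ ^ 2) '' feasibleVectors ξ ε) μ)
    (O : OpClass) :
    distillableSizes O (rankOne ψ.ofLp) ε = {m : ℕ | 1 ≤ m ∧ μ ≤ 1 / (m : ℝ)} := by
  ext m
  refine and_congr_right fun hm => ?_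
  have hsq : ∀ {x : ℝ}, 0 ≤ x → (1 - ε ≤ x ^ 2 ↔ √(1 - ε) ≤ x) := fun hx =>
    (Real.sqrt_le_left hx).symm
  obtain ⟨ω, ⟨h0, h1, h2⟩, hmax⟩ := exists_isMaxOn_dotProduct ξ (c := 1 / m) (by positivity)
  have hnn : ∀ {ω : Fin (min a b) → ℝ}, (∀ i, 0 ≤ ω i) → 0 ≤ ξ ⬝ᵥ ω := fun h =>
    Finset.sum_nonneg fun i _ => mul_nonneg (hξ.1 i) (h i)
  have hbd : ∀ x ∈ {x | ∃ Λ ∈ O.ops a b m m,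
      x = (((Λ (rankOne ψ.ofLp))ᴴ * maxEntangled m).trace).re}, x ≤ (ξ ⬝ᵥ ω) ^ 2 := by
    rintro x ⟨Λ, hΛ, rfl⟩
    obtain ⟨ω', h0', h1', h2', h3'⟩ := exists_vector_of_mem_ops hξ hΛ
    refine h3'.trans ?_
    have := hnn h0'
    gcongr
    exact hmax ω' h0' h1' h2'
  constructor
  · intro h
    -- Nonnegativity of the bound covers the default value `0` of `sSup` on the empty set.
    have h3 : 1 - ε ≤ (ξ ⬝ᵥ ω) ^ 2 := h.trans (Real.sSup_le hbd (sq_nonneg _))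
    have h4 : ω ∈ feasibleVectors ξ ε := ⟨(hsq (hnn h0)).1 h3, h1, h0⟩
    exact (hμ.2 ⟨ω, h4, rfl⟩).trans ((norm_sq_le_iff hd _ _).2 h2)
  · intro h
    obtain ⟨ω', ⟨h1', h2', h3'⟩, h4'⟩ := hμ.1
    obtain ⟨Λ, hΛ, hle⟩ := exists_oneWayLOCC hm hd hξ h2'
      ((norm_sq_le_iff hd _ _).1 (h4'.le.trans h))
    exact (((hsq (hnn h3')).2 h1').trans hle).trans (le_csSup ⟨_, hbd⟩ ⟨Λ, hΛ.mem_ops O, rfl⟩)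

end

theorem mainTheorem3 {a b : ℕ} (ψ : EuclideanSpace ℂ (Fin a × Fin b)) (hψ : ‖ψ‖ = 1)
    (ε : ℝ) (hε0 : 0 ≤ ε) (hε1 : ε < 1) :
    (∃ ξ : Fin (min a b) → ℝ, IsSchmidtVector ψ ξ) ∧
    ∀ ξ : Fin (min a b) → ℝ, IsSchmidtVector ψ ξ →
      (pureStateQCLP ξ ε).IsConvex ∧
      (∀ (ω : Fin (min a b) → ℝ) (s : ℝ),
        Sum.elim ω (fun _ => s) ∈ (pureStateQCLP ξ ε).feasible ↔
          ω ∈ feasibleVectors ξ ε ∧ ‖ω‖ ^ 2 ≤ s) ∧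
      ∃ μ : ℝ, 0 < μ ∧
        IsLeast ((fun ω : Fin (min a b) → ℝ => ‖ω‖ ^ 2) '' feasibleVectors ξ ε) μ ∧
        IsLeast ((fun x => (pureStateQCLP ξ ε).c ⬝ᵥ x) '' (pureStateQCLP ξ ε).feasible) μ ∧
        ∀ O : OpClass,
          (∃ M, IsGreatest (distillableSizes O (rankOne ψ.ofLp) ε) M) ∧
          distillableEntanglement O (rankOne ψ.ofLp) ε = logFloor (-Real.logb 2 μ) := by
  refine ⟨exists_isSchmidtVector ψ, fun ξ hξ => ?_⟩
  have hξξ : ξ ⬝ᵥ ξ = 1 := by rw [hξ.dotProduct_self, hψ, one_pow]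
  have hd : 0 < min a b := by
    rw [Nat.pos_iff_ne_zero]
    intro h
    have : IsEmpty (Fin (min a b)) := by rw [h]; infer_instance
    simp [dotProduct] at hξξ
  have hfeas := mem_feasible_pureStateQCLP_iff hd ξ ε
  refine ⟨isConvex_pureStateQCLP ξ ε, hfeas, ?_⟩
  have hξ1 : ∑ i, ξ i ^ 2 = 1 := by
    rw [← hξξ]
    exact Finset.sum_congr rfl fun i _ => sq _
  have hξmem : ξ ∈ feasibleVectors ξ ε :=
    ⟨by rw [hξξ]; exact Real.sqrt_le_one.2 (by linarith), (norm_toLp_le_one_iff ξ).2 hξ1.le, hξ.1⟩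
  obtain ⟨ω, hω, hmin⟩ := (isCompact_feasibleVectors ξ ε).exists_isMinOn ⟨ξ, hξmem⟩
    (continuous_norm.pow 2).continuousOn
  have hμ : IsLeast ((fun ω : Fin (min a b) → ℝ => ‖ω‖ ^ 2) '' feasibleVectors ξ ε) (‖ω‖ ^ 2) := by
    refine ⟨⟨ω, hω, rfl⟩, ?_⟩
    rintro _ ⟨ω', hω', rfl⟩
    exact hmin hω'
  have hpos : 0 < ‖ω‖ ^ 2 := by
    have : ω ≠ 0 := by
      rintro rfl
      have h1 := hω.1
      rw [dotProduct_zero] at h1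
      exact absurd (Real.sqrt_pos.2 (by linarith : 0 < 1 - ε)) (not_lt.2 h1)
    have := norm_pos_iff.2 this
    positivity
  -- The feasible point `ξ` shows that the minimum is at most `1`, hence `⌊μ⁻¹⌋₊ ≥ 1`.
  have hle1 : ‖ω‖ ^ 2 ≤ 1 := (hmin hξmem).trans ((norm_sq_le_iff hd ξ 1).2 fun i => by
    rw [← hξ1]
    exact Finset.single_le_sum (f := fun i => ξ i ^ 2) (fun j _ => sq_nonneg _)
      (Finset.mem_univ i))
  generalize ‖ω‖ ^ 2 = μ at hμ hpos hle1
  refine ⟨μ, hpos, hμ, ⟨?_, ?_⟩, fun O => ?_⟩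
  · obtain ⟨ω', hω', h⟩ := hμ.1
    exact ⟨Sum.elim ω' fun _ => μ, (hfeas ω' μ).2 ⟨hω', h.le⟩, dotProduct_c_pureStateQCLP _ _ _⟩
  · rintro _ ⟨x, hx, rfl⟩
    have hxe : x = Sum.elim (fun i => x (Sum.inl i)) fun _ => x (Sum.inr ()) := by
      ext (i | i) <;> rfl
    rw [hxe, hfeas] at hx
    dsimp only
    rw [dotProduct_c_pureStateQCLP]
    exact (hμ.2 ⟨_, hx.1, rfl⟩).trans hx.2
  · have hG : IsGreatest (distillableSizes O (rankOne ψ.ofLp) ε) ⌊μ⁻¹⌋₊ := by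
      rw [distillableSizes_eq hd hξ hμ]
      have h1 : 1 ≤ ⌊μ⁻¹⌋₊ := Nat.le_floor (by simpa using (one_le_inv₀ hpos).2 hle1)
      have h1' : (0 : ℝ) < ⌊μ⁻¹⌋₊ := by exact_mod_cast h1
      refine ⟨⟨h1, ?_⟩, fun m hm => ?_⟩
      · rw [one_div, le_inv_comm₀ hpos h1']
        exact Nat.floor_le (inv_nonneg.2 hpos.le)
      · have hm0 : (0 : ℝ) < m := by exact_mod_cast hm.1
        refine Nat.le_floor ?_
        have := hm.2
        rwa [one_div, le_inv_comm₀ hpos hm0] at this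
    refine ⟨⟨_, hG⟩, ?_⟩
    rw [distillableEntanglement, hG.csSup_eq, logFloor, Real.rpow_neg zero_le_two,
      Real.rpow_logb zero_lt_two (by norm_num) hpos,
      natCast_floor_eq_intCast_floor (inv_nonneg.2 hpos.le)]
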